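/- Let $A$ be a real symmetric $d\times d$ matrix ($d\ge 1$) with eigenvalues $\lambda_1,\dots,\lambda_d$ and corresponding orthonormal eigenvectors $u_1,\dots,u_d$, and let $\lambda_{\max},\lambda_{\min}$ be its largest and smallest eigenvalues. Let $\varphi(\cdot;A)=d^{-1}\sum_{i=1}^d\delta_{\lambda_i}$ be its spectral density and, for $b\in\mathbb{R}^d$, let $\psi(\cdot;A,b)=\sum_{i=1}^d |u_i^{\top}b|^2\,\delta_{\lambda_i}$. For a finitely supported probability measure $\mu$ on $\mathbb{R}$, let $p_0,p_1,\dots$ be the orthonormal polynomials of $\mu$ ($\deg p_n=n$, positive leading coefficient; if $\mu$ has only $s$ points of support, put $p_n=0$ for $n\ge s$), let $\alpha_n=\int x\,p_n^2\,d\mu$ and $\beta_n=\int x\,p_np_{n+1}\,d\mu$, and let $M_k(\mu)$ be the symmetric tridiagonal $k\times k$ matrix with diagonal $\alpha_0,\dots,\alpha_{k-1}$ and off-diagonals $\beta_0,\dots,\beta_{k-2}$. The $k$-point Gaussian quadrature rule for $\mu$ is $\mu_k=\psi(\cdot;M_k(\mu),e_1)$. Write $\psi_k(\cdot;A,b)$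 for the $k$-point Gaussian quadrature rule for $\psi(\cdot;A,b)$. Let $b_1,\dots,b_m$ be independent random vectors, each uniformly distributed on the unit sphere $\mathbb{S}^{d-1}$ of $\mathbb{R}^d$. The $(k,m)$ stochastic Lanczos quadrature approximation to $\varphi(\cdot;A)$ is $\psi^{\mathrm{SLQ}}_{k,m}=\frac1m\sum_{\ell=1}^m\psi_k(\cdot;A,b_\ell)$. For probability measures $\mu_1,\mu_2$ on $\mathbb{R}$ with cumulative distribution functions $M_1,M_2$, let $d_W(\mu_1,\mu_2)=\int_{\mathbb{R}}|M_1(x)-M_2(x)|\,dx$. **Theorem 8.4.** There is a universal constant $C>0$ such that for all integers $d,m\ge 1$ and $k$, all real symmetric $d\times d$ matrices $A$ and all real $\varepsilon,\delta>0$ with $$m\ \ge\ \frac{\log^2(\varepsilon^{-1})\,\log(\varepsilon^{-1}\delta^{-1})}{d\,\varepsilon^2},\qquad k\ \ge\ \frac1\varepsilon,$$ one has $$\mathbb{P}\Big[d_W\big(\varphi(\cdot;A),\psi^{\mathrm{SLQ}}_{k,m}\big)>|\lambda_{\max}-\lambda_{\min}|\,C\varepsilon\Big]\le\delta .$$ 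-/

import Mathlib

open MeasureTheory ProbabilityTheory
open scoped ENNReal

namespace SLQ

noncomputable section

/-- The spectral density `φ(·; A) = d⁻¹ ∑ᵢ δ(x - λᵢ)` of a real symmetric `d × d` matrix `A`, as a
measure on the real line. (Over `ℝ`, `Matrix.IsHermitian` means symmetric.) -/
def spectralDensity {d : ℕ} {A : Matrix (Fin d) (Fin d) ℝ} (hA : A.IsHermitian) : Measure ℝ :=
  (d : ℝ≥0∞)⁻¹ • ∑ i, Measure.dirac (hA.eigenvalues i)

/-- The eigenvector spectral density `ψ(·; A, b) = ∑ᵢ |uᵢᵀ b|² δ(x - λᵢ)` of a real symmetric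
matrix `A` and a vector `b`, where the `uᵢ` are orthonormal eigenvectors of `A`. -/
def eigenvectorDensity {d : ℕ} {A : Matrix (Fin d) (Fin d) ℝ} (hA : A.IsHermitian)
    (b : EuclideanSpace ℝ (Fin d)) : Measure ℝ :=
  ∑ i, ENNReal.ofReal ((inner ℝ (hA.eigenvectorBasis i) b) ^ 2) •
    Measure.dirac (hA.eigenvalues i)

/-- The largest eigenvalue. -/
def lambdaMax {d : ℕ} {A : Matrix (Fin d) (Fin d) ℝ} (hA : A.IsHermitian) : ℝ :=
  ⨆ i, hA.eigenvalues i

/-- The smallest eigenvalue. -/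
def lambdaMin {d : ℕ} {A : Matrix (Fin d) (Fin d) ℝ} (hA : A.IsHermitian) : ℝ :=
  ⨅ i, hA.eigenvalues i

/-- The inner product `⟨p, q⟩_μ = ∫ p q dμ` on polynomials (`μ` is assumed to have finite
moments; it is only used for finitely supported `μ`). -/
def polyInner (μ : Measure ℝ) (p q : Polynomial ℝ) : ℝ :=
  ∫ x, p.eval x * q.eval x ∂μ

/-- The orthonormal polynomials `p₀, p₁, …` of `μ`, with `deg pₙ = n` and positive leading
coefficient: the Gram–Schmidt process for `⟨·, ·⟩_μ` applied to `1, x, x², …`.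
If `μ` is supported on only `s` points, then `p₀, …, p_{s-1}` are as just described, while the
residual of `xⁿ` has norm `0` for `n ≥ s`, and then `pₙ = 0` by the convention `0⁻¹ = 0`
(the sequence terminates). -/
def orthoPoly (μ : Measure ℝ) (n : ℕ) : Polynomial ℝ :=
  let r : Polynomial ℝ := Polynomial.X ^ n -
    ∑ j : Fin n, polyInner μ (Polynomial.X ^ n) (orthoPoly μ j) • orthoPoly μ j
  (Real.sqrt (polyInner μ r r))⁻¹ • r
termination_by n
decreasing_by exact j.isLt

/-- The diagonal recurrence coefficient `αₙ = ⟨x pₙ, pₙ⟩_μ` in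
`x pₙ = βₙ₋₁ pₙ₋₁ + αₙ pₙ + βₙ pₙ₊₁`. -/
def recAlpha (μ : Measure ℝ) (n : ℕ) : ℝ :=
  polyInner μ (Polynomial.X * orthoPoly μ n) (orthoPoly μ n)

/-- The off-diagonal recurrence coefficient `βₙ = ⟨x pₙ, pₙ₊₁⟩_μ` in
`x pₙ = βₙ₋₁ pₙ₋₁ + αₙ pₙ + βₙ pₙ₊₁`. -/
def recBeta (μ : Measure ℝ) (n : ℕ) : ℝ :=
  polyInner μ (Polynomial.X * orthoPoly μ n) (orthoPoly μ (n + 1))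

/-- The symmetric tridiagonal `k × k` matrix `M_k(μ)` with diagonal `α₀, …, α_{k-1}` and
off-diagonals `β₀, …, β_{k-2}`. If `μ` is supported on only `s < k` points, this is the
`s × s` Jacobi matrix of `μ` padded by a zero block that is decoupled from it, as `β_{s-1} = 0`. -/
def jacobiMatrix (μ : Measure ℝ) (k : ℕ) : Matrix (Fin k) (Fin k) ℝ :=
  Matrix.of fun i j =>
    if i = j then recAlpha μ i
    else if (i : ℕ) + 1 = j then recBeta μ i
    else if (j : ℕ) + 1 = i then recBeta μ j
    else 0

lemma jacobiMatrix_isHermitian (μ : Measure ℝ) (k : ℕ) : (jacobiMatrix μ k).IsHermitian := by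
  ext i j
  simp only [jacobiMatrix, Matrix.conjTranspose_apply, Matrix.of_apply, star_trivial]
  by_cases h : i = j
  · subst h; simp
  · have h' : j ≠ i := fun e => h e.symm
    simp only [h, h', if_false]
    by_cases h1 : (i : ℕ) + 1 = j
    · have h2 : ¬ ((j : ℕ) + 1 = i) := by omega
      simp [h1, h2]
    · simp [h1]

/-- The first canonical basis vector of `ℝᵏ`. -/
def firstBasisVector (k : ℕ) : EuclideanSpace ℝ (Fin k) :=
  WithLp.toLp 2 fun i => if (i : ℕ) = 0 then 1 else 0

/-- The `k`-point Gaussian quadrature rule `μ_k = ψ(·; M_k(μ), e₁)` for `μ`: its nodes are the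
eigenvalues of `M_k(μ)`, its weights the squared first components of the eigenvectors. -/
def gaussQuadrature (k : ℕ) (μ : Measure ℝ) : Measure ℝ :=
  eigenvectorDensity (jacobiMatrix_isHermitian μ k) (firstBasisVector k)

/-- The `(k, m)` stochastic Lanczos quadrature approximation
`m⁻¹ ∑_ℓ ψ_k(·; A, b_ℓ)` to the spectral density of `A`. -/
def slq {d m : ℕ} (k : ℕ) {A : Matrix (Fin d) (Fin d) ℝ} (hA : A.IsHermitian)
    (b : Fin m → EuclideanSpace ℝ (Fin d)) : Measure ℝ :=
  (m : ℝ≥0∞)⁻¹ • ∑ l, gaussQuadrature k (eigenvectorDensity hA (b l))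

/-- The uniform distribution on the unit sphere `S^{d-1}` of `ℝᵈ`: normalized surface measure. -/
def sphereUniform (d : ℕ) : Measure (Metric.sphere (0 : EuclideanSpace ℝ (Fin d)) 1) :=
  ((volume : Measure (EuclideanSpace ℝ (Fin d))).toSphere Set.univ)⁻¹ •
    (volume : Measure (EuclideanSpace ℝ (Fin d))).toSphere

/-- The Wasserstein distance `∫ |M₁(x) - M₂(x)| dx` of two probability measures on the line, where
`M₁, M₂` are the cumulative distribution functions. It takes values in `[0, ∞]`, so that no
integrability is presupposed. -/
def wasserstein (μ₁ μ₂ : Measure ℝ) : ℝ≥0∞ :=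
  ∫⁻ x, ENNReal.ofReal |μ₁.real (Set.Iic x) - μ₂.real (Set.Iic x)|

end

end SLQ

/-! The distance is split by the triangle inequality at the mean of the measures `ψ(·; A, b_ℓ)`; one
part is a deterministic quadrature error, the other a sampling error.

Quadrature error. The mean minus its Gaussian rules is a signed, finitely supported measure on
`[λ_min, λ_max]` of total variation at most 2. It annihilates polynomials of degree less than `k`
(`sum_gaussQuadrature_eval`, `gaussQuadrature_node_mem`). The `L¹` norm of its distribution function
is its pairing with some 1-Lipschitz function (`lintegral_abs_sum_step_le`). Jackson's theorem
(`exists_polynomial_near_lipschitz`) replaces that function by a polynomial of degree less than `k`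
at a cost proportional to `(λ_max - λ_min) / k`.

Sampling error. At a fixed `x` the gap between the distribution functions is, up to sign, a centred
mean of `m` independent copies of the squared norm of a projection of a uniform point of the sphere.
A Gaussian integral in polar coordinates evaluates `E[Q(y)^(-d/2)]` for a diagonal quadratic form
`Q` (`sphereUniform_quadratic`), which makes each copy sub-Gaussian with variance proxy `8/d`, and
their mean with proxy `8/(dm)`. Jensen's inequality in `x` followed by a single Markov inequality
controls the integral over `x` (`measure_lintegral_cdfGap_le`), with no union bound over `x`. -/

/-! ### Jackson's theorem via a discrete positive kernel -/

/-- The squared modulus of the trigonometric polynomial with coefficients `c 0, …, c (L - 1)`. -/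
noncomputable def trigSq (c : ℕ → ℝ) (L : ℕ) (φ : ℝ) : ℝ :=
  Complex.normSq (∑ l ∈ Finset.range L, (c l : ℂ) * Complex.exp (φ * Complex.I) ^ l)

lemma trigSq_nonneg (c : ℕ → ℝ) (L : ℕ) (φ : ℝ) : 0 ≤ trigSq c L φ := Complex.normSq_nonneg _

lemma trigSq_eq_sum (c : ℕ → ℝ) (L : ℕ) (φ : ℝ) :
    trigSq c L φ = ∑ l ∈ Finset.range L, ∑ l' ∈ Finset.range L,
      c l * c l' * Real.cos (((l : ℤ) - (l' : ℤ) : ℤ) * φ) := by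
  have hz : ∀ l : ℕ, Complex.exp (φ * Complex.I) ^ l
      = (Real.cos (l * φ) : ℂ) + Real.sin (l * φ) * Complex.I := by
    intro l
    rw [← Complex.exp_nat_mul, ← mul_assoc, Complex.exp_mul_I]
    push_cast
    rfl
  have hsum : ∑ l ∈ Finset.range L, (c l : ℂ) * Complex.exp (φ * Complex.I) ^ l
      = ((∑ l ∈ Finset.range L, c l * Real.cos (l * φ) : ℝ) : ℂ)
        + ((∑ l ∈ Finset.range L, c l * Real.sin (l * φ) : ℝ) : ℂ) * Complex.I := by
    simp only [hz]
    push_cast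
    rw [Finset.sum_mul, ← Finset.sum_add_distrib]
    refine Finset.sum_congr rfl fun l _ => by ring
  rw [trigSq, hsum, Complex.normSq_add_mul_I, sq, sq, Finset.sum_mul_sum, Finset.sum_mul_sum,
    ← Finset.sum_add_distrib]
  refine Finset.sum_congr rfl fun l _ => ?_
  rw [← Finset.sum_add_distrib]
  refine Finset.sum_congr rfl fun l' _ => ?_
  push_cast
  rw [sub_mul, Real.cos_sub]
  ring

lemma trigSq_neg (c : ℕ → ℝ) (L : ℕ) (φ : ℝ) : trigSq c L (-φ) = trigSq c L φ := by
  simp only [trigSq_eq_sum, mul_neg, Real.cos_neg]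

/-- Real part of a geometric series whose ratio `ζ ^ m` is an `N`-th root of unity other than 1. -/
lemma sum_cos_equispaced {N : ℕ} {m : ℤ} (hm : m ≠ 0) (hmN : m.natAbs < N) (θ : ℝ) :
    ∑ j ∈ Finset.range N, Real.cos (m * (θ + 2 * Real.pi * j / N)) = 0 := by
  have hN : N ≠ 0 := by omega
  have hprim := Complex.isPrimitiveRoot_exp N hN
  set ζ := Complex.exp (2 * Real.pi * Complex.I / N) with hζ
  have hne : ζ ^ m ≠ 1 := by
    intro h
    have := (hprim.zpow_eq_one_iff_dvd m).1 h
    have := Int.natAbs_dvd_natAbs.2 this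
    have := Nat.le_of_dvd (by omega) this
    simp at this
    omega
  have hgeom : ∑ j ∈ Finset.range N, (ζ ^ m) ^ j = 0 := by
    rw [geom_sum_eq hne, ← zpow_natCast, ← zpow_mul, mul_comm, zpow_mul, zpow_natCast,
      hprim.pow_eq_one]
    simp
  have hterm : ∀ j : ℕ, Real.cos (m * (θ + 2 * Real.pi * j / N))
      = (Complex.exp (m * θ * Complex.I) * (ζ ^ m) ^ j).re := by
    intro j
    rw [hζ, ← Complex.exp_int_mul, ← Complex.exp_nat_mul, ← Complex.exp_add,
      ← Complex.exp_ofReal_mul_I_re]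
    congr 2
    push_cast
    ring
  simp only [hterm]
  rw [← Complex.re_sum, ← Finset.mul_sum, hgeom]
  simp

/-- Discrete Parseval: all frequencies `l - l'` are smaller than `N` in modulus, so only the
diagonal terms survive the sum over the grid. -/
lemma sum_trigSq_add (c : ℕ → ℝ) {L N : ℕ} (h : L ≤ N) (θ : ℝ) :
    ∑ j ∈ Finset.range N, trigSq c L (θ + 2 * Real.pi * j / N)
      = N * ∑ l ∈ Finset.range L, c l ^ 2 := by
  simp only [trigSq_eq_sum]
  rw [Finset.sum_comm, Finset.mul_sum]
  refine Finset.sum_congr rfl fun l hl => ?_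
  rw [Finset.sum_comm, Finset.sum_eq_single l]
  · simp only [sub_self, Int.cast_zero, zero_mul, Real.cos_zero, mul_one, Finset.sum_const,
      Finset.card_range, nsmul_eq_mul]
    ring
  · intro l' hl' hne
    rw [← Finset.mul_sum, sum_cos_equispaced, mul_zero]
    · omega
    · rw [Finset.mem_range] at hl hl'
      omega
  · intro h'
    exact absurd hl h'

lemma sum_trigSq_sub (c : ℕ → ℝ) {L N : ℕ} (h : L ≤ N) (θ : ℝ) :
    ∑ j ∈ Finset.range N, trigSq c L (θ - 2 * Real.pi * j / N)
      = N * ∑ l ∈ Finset.range L, c l ^ 2 := by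
  rw [← sum_trigSq_add c h (-θ)]
  refine Finset.sum_congr rfl fun j _ => ?_
  rw [← trigSq_neg]
  congr 1
  ring

/-- The left factor is `|1 - z|²` with `z = exp(iφ)`, and multiplying by `1 - z` differences the
coefficients: `(l + 1)(k - l) - l(k - l + 1) = k - 2l`. This makes the second moment of the kernel
computable by Parseval. -/
lemma two_sub_two_cos_mul_trigSq (k : ℕ) (φ : ℝ) :
    (2 - 2 * Real.cos φ) * trigSq (fun l => (l + 1) * (k - l)) k φ
      = trigSq (fun l => k - 2 * l) (k + 1) φ := by
  set z := Complex.exp (φ * Complex.I) with hz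
  -- Partial sums with `k` fixed; at `n = k` the boundary term is `-k z ^ k`, the last coefficient
  -- `k - 2k`.
  have key : ∀ n : ℕ, (1 - z) * ∑ l ∈ Finset.range n, (((l + 1) * (k - l) : ℝ) : ℂ) * z ^ l
      = ∑ l ∈ Finset.range n, (((k : ℝ) - 2 * l : ℝ) : ℂ) * z ^ l - n * (k - n + 1) * z ^ n := by
    intro n
    induction n with
    | zero => simp
    | succ n ih =>
      rw [Finset.sum_range_succ, mul_add, ih, Finset.sum_range_succ]
      push_cast
      ring
  have h1 : Complex.normSq (1 - z) = 2 - 2 * Real.cos φ := by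
    rw [hz, Complex.exp_mul_I, Complex.normSq_apply]
    simp only [Complex.sub_re, Complex.one_re, Complex.add_re, Complex.mul_re, Complex.I_re,
      Complex.I_im, Complex.sub_im, Complex.one_im, Complex.add_im, Complex.mul_im,
      Complex.cos_ofReal_re, Complex.cos_ofReal_im, Complex.sin_ofReal_re, Complex.sin_ofReal_im]
    have := Real.sin_sq_add_cos_sq φ
    nlinarith
  rw [trigSq, trigSq, ← h1, ← Complex.normSq_mul, key k, Finset.sum_range_succ]
  congr 1
  push_cast
  ring

lemma sum_parabola_sq (k : ℕ) :
    (∑ l ∈ Finset.range k, (((l : ℝ) + 1) * (k - l)) ^ 2)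
      = (k : ℝ) * (k + 1) * (k + 2) * ((k : ℝ) ^ 2 + 2 * k + 2) / 30 := by
  have key : ∀ n : ℕ, (∑ l ∈ Finset.range n, (((l : ℝ) + 1) * (k - l)) ^ 2)
      = ((k : ℝ) + 1) ^ 2 * ((n : ℝ) * (n + 1) * (2 * n + 1) / 6)
        - 2 * ((k : ℝ) + 1) * ((n : ℝ) * (n + 1) / 2) ^ 2
        + (n : ℝ) * (n + 1) * (2 * n + 1) * (3 * (n : ℝ) ^ 2 + 3 * n - 1) / 30 := by
    intro n
    induction n with
    | zero => simp
    | succ n ih =>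
      rw [Finset.sum_range_succ, ih]
      push_cast
      ring
  rw [key]
  ring

lemma sum_linear_sq (k : ℕ) :
    (∑ l ∈ Finset.range (k + 1), ((k : ℝ) - 2 * l) ^ 2) = (k : ℝ) * (k + 1) * (k + 2) / 3 := by
  have key : ∀ n : ℕ, (∑ l ∈ Finset.range n, ((k : ℝ) - 2 * l) ^ 2)
      = (n : ℝ) * (k : ℝ) ^ 2 - 2 * (k : ℝ) * n * (n - 1)
        + 4 * (((n : ℝ) - 1) * n * (2 * n - 1) / 6) := by
    intro n
    induction n with
    | zero => simp
    | succ n ih =>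
      rw [Finset.sum_range_succ, ih]
      push_cast
      ring
  rw [key]
  push_cast
  ring

lemma sq_cos_sub_cos_le (s t : ℝ) : (Real.cos s - Real.cos t) ^ 2 ≤ 2 - 2 * Real.cos (s - t) := by
  rw [Real.cos_sub]
  nlinarith [sq_nonneg (Real.sin s - Real.sin t), Real.sin_sq_add_cos_sq s,
    Real.sin_sq_add_cos_sq t]

/-- AM-GM `2x ≤ k x² + 1/k` trades the first moment of the kernel for the second moment, balanced at
distance `1/k`. -/
lemma abs_cos_sub_cos_le {k : ℝ} (hk : 0 < k) (s t : ℝ) :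
    |Real.cos s - Real.cos t| ≤ (k * (2 - 2 * Real.cos (s - t)) + 1 / k) / 2 := by
  have h := sq_cos_sub_cos_le s t
  rw [← sq_abs] at h
  set x := |Real.cos s - Real.cos t|
  have h1 : 2 * x ≤ k * x ^ 2 + 1 / k := by
    have : k * x ^ 2 + 1 / k - 2 * x = (k * x - 1) ^ 2 / k := by field_simp; ring
    have : 0 ≤ (k * x - 1) ^ 2 / k := by positivity
    linarith
  nlinarith

/-- Jackson's theorem for Lipschitz functions on `[-1, 1]`. -/
theorem exists_polynomial_near_lipschitz {k : ℕ} (hk : 1 ≤ k) (f : ℝ → ℝ)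
    (hf : ∀ x ∈ Set.Icc (-1 : ℝ) 1, ∀ y ∈ Set.Icc (-1 : ℝ) 1, |f x - f y| ≤ |x - y|) :
    ∃ p : Polynomial ℝ, p.natDegree < k ∧ ∀ x ∈ Set.Icc (-1 : ℝ) 1, |p.eval x - f x| ≤ 6 / k := by
  set a : ℕ → ℝ := fun l => (l + 1) * (k - l) with ha
  set S := ∑ l ∈ Finset.range k, a l ^ 2 with hS
  -- The second-moment polynomial has `k + 1` coefficients, so `k + 1` nodes are the fewest for
  -- which `sum_trigSq_add` applies to it.
  set N := k + 1 with hN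
  set t : ℕ → ℝ := fun j => 2 * Real.pi * j / N with ht
  have hk0 : (1 : ℝ) ≤ k := by exact_mod_cast hk
  have hSval : S = k * (k + 1) * (k + 2) * (k ^ 2 + 2 * k + 2) / 30 := sum_parabola_sq k
  have hSpos : 0 < S := by rw [hSval]; positivity
  have hNpos : (0 : ℝ) < N := by positivity
  set p : Polynomial ℝ := ∑ l ∈ Finset.range k, ∑ l' ∈ Finset.range k,
    Polynomial.C (a l * a l' / (N * S) * ∑ j ∈ Finset.range N, f (Real.cos (t j)) *
      Real.cos (((l : ℤ) - (l' : ℤ) : ℤ) * t j)) * Polynomial.Chebyshev.T ℝ ((l : ℤ) - (l' : ℤ))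
    with hp
  have hpdeg : p.natDegree < k := by
    have : p.natDegree ≤ k - 1 := by
      refine Polynomial.natDegree_sum_le_of_forall_le _ _ fun l hl => ?_
      refine Polynomial.natDegree_sum_le_of_forall_le _ _ fun l' hl' => ?_
      refine (Polynomial.natDegree_C_mul_le _ _).trans ?_
      rw [Polynomial.Chebyshev.natDegree_T]
      rw [Finset.mem_range] at hl hl'
      omega
    omega
  -- Symmetrizing turns `cos n(θ ∓ t)` into `cos nθ cos nt`, so `w` is a polynomial in `cos θ`. The
  -- weights are nonnegative and sum to 1, hence `p` averages the values of `f` at the nodes.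
  set w : ℝ → ℕ → ℝ := fun θ j => (trigSq a k (θ - t j) + trigSq a k (θ + t j)) / (2 * N * S)
    with hw
  have hpeval : ∀ θ, p.eval (Real.cos θ) = ∑ j ∈ Finset.range N, w θ j * f (Real.cos (t j)) := by
    intro θ
    simp only [hp, Polynomial.eval_finsetSum, Polynomial.eval_mul, Polynomial.eval_C,
      Polynomial.Chebyshev.T_real_cos]
    have : ∀ j, w θ j * f (Real.cos (t j)) = ∑ l ∈ Finset.range k, ∑ l' ∈ Finset.range k,
        a l * a l' / (N * S) * (f (Real.cos (t j)) * Real.cos (((l : ℤ) - (l' : ℤ) : ℤ) * t j)) *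
          Real.cos (((l : ℤ) - (l' : ℤ) : ℤ) * θ) := by
      intro j
      simp only [hw, trigSq_eq_sum]
      rw [← Finset.sum_add_distrib, Finset.sum_div, Finset.sum_mul]
      refine Finset.sum_congr rfl fun l _ => ?_
      rw [← Finset.sum_add_distrib, Finset.sum_div, Finset.sum_mul]
      refine Finset.sum_congr rfl fun l' _ => ?_
      rw [mul_sub, mul_add, Real.cos_sub, Real.cos_add]
      field_simp
      ring
    simp only [this]
    conv_rhs => rw [Finset.sum_comm]
    refine Finset.sum_congr rfl fun l _ => ?_
    conv_rhs => rw [Finset.sum_comm]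
    refine Finset.sum_congr rfl fun l' _ => ?_
    rw [Finset.mul_sum, Finset.sum_mul]
  have hwpos : ∀ θ j, 0 ≤ w θ j := fun θ j => by
    have := trigSq_nonneg a k (θ - t j)
    have := trigSq_nonneg a k (θ + t j)
    simp only [hw]
    positivity
  have hwsum : ∀ θ, ∑ j ∈ Finset.range N, w θ j = 1 := by
    intro θ
    simp only [hw]
    rw [← Finset.sum_div, Finset.sum_add_distrib, sum_trigSq_sub a (by omega) θ,
      sum_trigSq_add a (by omega) θ]
    field_simp
    ring
  refine ⟨p, hpdeg, fun x hx => ?_⟩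
  obtain ⟨θ, rfl⟩ : ∃ θ, Real.cos θ = x := ⟨Real.arccos x, Real.cos_arccos hx.1 hx.2⟩
  set S' := ∑ l ∈ Finset.range (k + 1), ((k : ℝ) - 2 * l) ^ 2 with hS'
  have hS'val : S' = k * (k + 1) * (k + 2) / 3 := sum_linear_sq k
  have hterm : ∀ j, w θ j * |f (Real.cos (t j)) - f (Real.cos θ)|
      ≤ (k * (trigSq (fun l => k - 2 * l) (k + 1) (θ - t j)
          + trigSq (fun l => k - 2 * l) (k + 1) (θ + t j))
        + (trigSq a k (θ - t j) + trigSq a k (θ + t j)) / k) / (4 * N * S) := by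
    intro j
    have h0 := hf _ ⟨Real.neg_one_le_cos (t j), Real.cos_le_one (t j)⟩ _ hx
    rw [abs_sub_comm (Real.cos (t j))] at h0
    have h1 := h0.trans (abs_cos_sub_cos_le (by linarith : (0 : ℝ) < k) θ (t j))
    -- Since `cos (-t) = cos t`, the same increment is also controlled by the angle `θ + t`,
    -- matching the second half of the weight.
    have h2 := h0.trans (by
      simpa only [Real.cos_neg, sub_neg_eq_add] using
        abs_cos_sub_cos_le (by linarith : (0 : ℝ) < k) θ (-t j))
    have e1 := mul_le_mul_of_nonneg_left h1 (trigSq_nonneg a k (θ - t j))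
    have e2 := mul_le_mul_of_nonneg_left h2 (trigSq_nonneg a k (θ + t j))
    have c1 := two_sub_two_cos_mul_trigSq k (θ - t j)
    have c2 := two_sub_two_cos_mul_trigSq k (θ + t j)
    rw [← c1, ← c2]
    simp only [hw]
    rw [div_mul_eq_mul_div, add_mul, div_le_div_iff₀ (by positivity) (by positivity)]
    have := mul_le_mul_of_nonneg_right (add_le_add e1 e2) (by positivity : 0 ≤ 4 * N * S)
    refine this.trans (le_of_eq ?_)
    field_simp
    ring
  have hsub : p.eval (Real.cos θ) - f (Real.cos θ)
      = ∑ j ∈ Finset.range N, w θ j * (f (Real.cos (t j)) - f (Real.cos θ)) := by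
    simp only [mul_sub]
    rw [Finset.sum_sub_distrib, ← Finset.sum_mul, hwsum, hpeval, one_mul]
  rw [hsub]
  refine (Finset.abs_sum_le_sum_abs _ _).trans ?_
  simp only [abs_mul, abs_of_nonneg (hwpos θ _)]
  refine (Finset.sum_le_sum fun j _ => hterm j).trans ?_
  rw [← Finset.sum_div, Finset.sum_add_distrib, ← Finset.sum_div, ← Finset.mul_sum,
    Finset.sum_add_distrib, Finset.sum_add_distrib, sum_trigSq_sub a (by omega) θ,
    sum_trigSq_add a (by omega) θ, sum_trigSq_sub _ (by omega) θ, sum_trigSq_add _ (by omega) θ,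
    ← hS, ← hS']
  -- The error is at most `k S' / (2S) + 1 / (2k)`, hence at most `5/k + 1/(2k)`.
  have hSS' : (k : ℝ) ^ 2 * S' ≤ 10 * S := by
    rw [hSval, hS'val]
    have : (0 : ℝ) ≤ k * (k + 1) * (k + 2) := by positivity
    nlinarith
  rw [div_le_div_iff₀ (by positivity) (by positivity)]
  have : (k * (N * S' + N * S') + (N * S + N * S) / k) * k = N * (2 * (k ^ 2 * S') + 2 * S) := by
    field_simp
    ring
  rw [this]
  nlinarith [mul_le_mul_of_nonneg_left hSS' hNpos.le, mul_pos hNpos hSpos]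

/-! ### Duality between distribution functions and Lipschitz functions -/

/-- A signed finitely supported measure on `[a, b]` that annihilates the polynomials of degree less
than `k` is small against Lipschitz functions. -/
lemma abs_sum_mul_lipschitz_le {ι : Type*} [Fintype ι] {c x : ι → ℝ} {a b : ℝ}
    (hab : a ≤ b) (hx : ∀ i, c i ≠ 0 → x i ∈ Set.Icc a b) (hc : ∑ i, |c i| ≤ 2) {k : ℕ}
    (hk : 1 ≤ k) (hmom : ∀ p : Polynomial ℝ, p.natDegree < k → ∑ i, c i * p.eval (x i) = 0)
    {f : ℝ → ℝ} (hf : ∀ y ∈ Set.Icc a b, ∀ z ∈ Set.Icc a b, |f y - f z| ≤ |y - z|) :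
    |∑ i, c i * f (x i)| ≤ 6 * (b - a) / k := by
  -- A one-point interval cannot be rescaled to `[-1, 1]`; there `f` agrees with a constant
  -- polynomial.
  rcases hab.eq_or_lt with rfl | hlt
  · have h1 : ∑ i, c i * f (x i) = ∑ i, c i * (Polynomial.C (f a)).eval (x i) := by
      refine Finset.sum_congr rfl fun i _ => ?_
      by_cases hi : c i = 0
      · simp [hi]
      · have := hx i hi
        rw [Set.Icc_self, Set.mem_singleton_iff] at this
        simp [this]
    rw [h1, hmom _ (by simp; omega)]
    simp
  set h := (b - a) / 2 with hh
  set m := (a + b) / 2 with hm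
  have hpos : 0 < h := by rw [hh]; linarith
  have hmaps : ∀ u ∈ Set.Icc (-1 : ℝ) 1, m + h * u ∈ Set.Icc a b := by
    rintro u ⟨h1, h2⟩
    constructor <;> nlinarith
  obtain ⟨p, hpdeg, hp⟩ := exists_polynomial_near_lipschitz hk (fun u => f (m + h * u) / h) (by
    intro u hu v hv
    rw [← sub_div, abs_div, abs_of_pos hpos, div_le_iff₀ hpos]
    refine (hf _ (hmaps u hu) _ (hmaps v hv)).trans (le_of_eq ?_)
    rw [show m + h * u - (m + h * v) = (u - v) * h by ring, abs_mul, abs_of_pos hpos])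
  set q : Polynomial ℝ := p.comp (Polynomial.C (1 / h) * (Polynomial.X - Polynomial.C m)) with hq
  have hqdeg : q.natDegree < k := by
    refine lt_of_le_of_lt Polynomial.natDegree_comp_le ?_
    refine lt_of_le_of_lt (Nat.mul_le_mul_left _ (m := 1) ?_) (by simpa using hpdeg)
    refine (Polynomial.natDegree_C_mul_le _ _).trans ?_
    simp
  have hqeval : ∀ y, q.eval y = p.eval ((y - m) / h) := by
    intro y
    simp [hq, Polynomial.eval_comp, div_eq_inv_mul]
  have hterm : ∀ i, |c i * (f (x i) - h * q.eval (x i))| ≤ |c i| * (h * (6 / k)) := by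
    intro i
    by_cases hi : c i = 0
    · simp [hi]
    rw [abs_mul]
    refine mul_le_mul_of_nonneg_left ?_ (abs_nonneg _)
    obtain ⟨h1, h2⟩ := hx i hi
    have := hp ((x i - m) / h) ⟨by rw [le_div_iff₀ hpos]; linarith,
      by rw [div_le_iff₀ hpos]; linarith⟩
    rw [mul_div_cancel₀ _ hpos.ne', add_sub_cancel, ← hqeval] at this
    have e : f (x i) - h * q.eval (x i) = -(h * (q.eval (x i) - f (x i) / h)) := by
      field_simp
      ring
    rw [e, abs_neg, abs_mul, abs_of_pos hpos]
    exact mul_le_mul_of_nonneg_left this hpos.le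
  have hsum : ∑ i, c i * f (x i) = ∑ i, c i * (f (x i) - h * q.eval (x i)) := by
    have := hmom q hqdeg
    simp only [mul_sub, Finset.sum_sub_distrib, mul_left_comm _ h]
    rw [← Finset.mul_sum, this]
    ring
  rw [hsum]
  refine (Finset.abs_sum_le_sum_abs _ _).trans ((Finset.sum_le_sum fun i _ => hterm i).trans ?_)
  rw [← Finset.sum_mul]
  have hk0 : (0 : ℝ) < k := by exact_mod_cast hk
  -- Total variation 2 times the approximation error `h · 6/k`, where `h` is half the length of the
  -- interval.
  refine (mul_le_mul_of_nonneg_right hc (by positivity)).trans (le_of_eq ?_)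
  rw [hh]
  ring

lemma intervalIntegral_mul_step {s : ℝ → ℝ} {a b y : ℝ} (hy : y ∈ Set.Icc a b) :
    ∫ t in a..b, s t * (if y ≤ t then 1 else 0) = ∫ t in y..b, s t := by
  rw [intervalIntegral.integral_of_le (hy.1.trans hy.2), intervalIntegral.integral_of_le hy.2]
  have : (fun t => s t * (if y ≤ t then (1 : ℝ) else 0)) = (Set.Ici y).indicator s := by
    ext t
    by_cases h : y ≤ t <;> simp [h]
  have hset : Set.Icc a b ∩ Set.Ici y = Set.Icc y b := by
    ext t
    simp only [Set.mem_inter_iff, Set.mem_Icc, Set.mem_Ici]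
    exact ⟨fun h => ⟨h.2, h.1.2⟩, fun h => ⟨⟨hy.1.trans h.1, h.2⟩, h.1⟩⟩
  rw [this, ← integral_Icc_eq_integral_Ioc, ← integral_Icc_eq_integral_Ioc,
    setIntegral_indicator measurableSet_Ici, hset]

/-- The `L¹` norm of the distribution function of a signed finitely supported measure on `[a, b]`
that annihilates the polynomials of degree less than `k`. -/
theorem lintegral_abs_sum_step_le {ι : Type*} [Fintype ι] {c x : ι → ℝ} {a b : ℝ}
    (hab : a ≤ b) (hx : ∀ i, c i ≠ 0 → x i ∈ Set.Icc a b) (hc : ∑ i, |c i| ≤ 2) {k : ℕ}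
    (hk : 1 ≤ k) (hmom : ∀ p : Polynomial ℝ, p.natDegree < k → ∑ i, c i * p.eval (x i) = 0) :
    ∫⁻ t, ENNReal.ofReal |∑ i, c i * (if x i ≤ t then 1 else 0)|
      ≤ ENNReal.ofReal (6 * (b - a) / k) := by
  set D : ℝ → ℝ := fun t => ∑ i, c i * (if x i ≤ t then 1 else 0) with hD
  have hDm : Measurable D := by
    refine Finset.measurable_sum _ fun i _ => Measurable.const_mul ?_ _
    exact Measurable.ite measurableSet_Ici measurable_const measurable_const
  have hDb : ∀ t, |D t| ≤ 2 := by
    intro t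
    refine (Finset.abs_sum_le_sum_abs _ _).trans ((Finset.sum_le_sum fun i _ => ?_).trans hc)
    rw [abs_mul]
    split_ifs <;> simp
  -- Left of `a` no atom is counted; right of `b` all are, and their total mass vanishes because `1`
  -- has degree `0 < k`. The point `a` may carry an atom but is null.
  have hD0 : ∀ t, t ∉ Set.Ioc a b → t ≠ a → D t = 0 := by
    intro t ht hta
    rw [Set.mem_Ioc, not_and_or, not_lt, not_le] at ht
    rcases ht with ht | ht
    · refine Finset.sum_eq_zero fun i _ => ?_
      by_cases hi : c i = 0
      · simp [hi]
      · have := (hx i hi).1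
        rw [if_neg (by rw [not_le]; exact (lt_of_le_of_ne ht hta).trans_le this), mul_zero]
    · rw [← hmom 1 (by simp; omega)]
      refine Finset.sum_congr rfl fun i _ => ?_
      by_cases hi : c i = 0
      · simp [hi]
      · rw [if_pos ((hx i hi).2.trans ht.le)]
        simp
  set s : ℝ → ℝ := fun t => (SignType.sign (D t) : ℝ) with hs
  have hsm : Measurable s := by
    have : s = fun t => if 0 < D t then 1 else if D t < 0 then -1 else 0 := by
      ext t
      simp only [hs, sign_apply]
      split_ifs <;> simp
    rw [this]
    exact Measurable.ite (measurableSet_lt measurable_const hDm) measurable_const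
      (Measurable.ite (measurableSet_lt hDm measurable_const) measurable_const measurable_const)
  have hsb : ∀ t, ‖s t‖ ≤ 1 := by
    intro t
    simp only [hs, sign_apply]
    split_ifs <;> simp
  have hsint : ∀ y z, IntervalIntegrable s volume y z := fun y z =>
    (intervalIntegrable_const (c := (1 : ℝ))).mono_fun hsm.aestronglyMeasurable
      (Filter.Eventually.of_forall fun t => by simpa using hsb t)
  -- The optimal test function: integrating by parts, `∫ |D| = ∫ s D` equals the pairing of the
  -- signed measure with this antiderivative of the sign, which is 1-Lipschitz.
  set f : ℝ → ℝ := fun y => ∫ t in y..b, s t with hf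
  have hfl : ∀ y z, |f y - f z| ≤ |y - z| := by
    intro y z
    have : f y - f z = ∫ t in y..z, s t := by
      simp only [hf]
      rw [sub_eq_iff_eq_add, intervalIntegral.integral_add_adjacent_intervals] <;> exact hsint _ _
    rw [this, abs_sub_comm]
    simpa using intervalIntegral.norm_integral_le_of_norm_le_const (a := y) (b := z) (C := 1)
      (f := s) fun t _ => hsb t
  have h1 : ∫⁻ t, ENNReal.ofReal |D t| = ∫⁻ t in Set.Ioc a b, ENNReal.ofReal |D t| := by
    rw [← lintegral_indicator measurableSet_Ioc]
    refine lintegral_congr_ae ?_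
    filter_upwards [Measure.ae_ne volume a] with t ht
    by_cases h : t ∈ Set.Ioc a b
    · rw [Set.indicator_of_mem h]
    · rw [Set.indicator_of_notMem h, hD0 t h ht]
      simp
  have hDint : Integrable (fun t => |D t|) (volume.restrict (Set.Ioc a b)) := by
    refine Integrable.of_bound (C := 2) (continuous_abs.measurable.comp hDm).aestronglyMeasurable ?_
    exact Filter.Eventually.of_forall fun t => by simpa using hDb t
  have h2 : ∫ t in a..b, |D t| = ∑ i, c i * f (x i) := by
    have : ∀ t, |D t| = ∑ i, c i * (s t * (if x i ≤ t then 1 else 0)) := by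
      intro t
      rw [← sign_mul_self (D t)]
      change s t * D t = _
      simp only [hD, Finset.mul_sum]
      exact Finset.sum_congr rfl fun i _ => by ring
    simp only [this]
    rw [intervalIntegral.integral_finsetSum]
    · refine Finset.sum_congr rfl fun i _ => ?_
      rw [intervalIntegral.integral_const_mul]
      by_cases hi : c i = 0
      · simp [hi]
      · rw [intervalIntegral_mul_step (hx i hi)]
    · intro i _
      refine IntervalIntegrable.const_mul ?_ _
      refine (hsint a b).mono_fun ?_ (Filter.Eventually.of_forall fun t => ?_)
      · exact (hsm.mul (Measurable.ite measurableSet_Ici measurable_const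
          measurable_const)).aestronglyMeasurable
      · simp only [norm_mul]
        split_ifs <;> simp
  rw [h1, ← ofReal_integral_eq_lintegral_ofReal hDint
    (Filter.Eventually.of_forall fun t => abs_nonneg _), ← intervalIntegral.integral_of_le hab, h2]
  exact ENNReal.ofReal_le_ofReal ((le_abs_self _).trans
    (abs_sum_mul_lipschitz_le hab hx hc hk hmom fun y _ z _ => hfl y z))

namespace SLQ

/-! ### Orthonormal polynomials, including the degenerate case -/

lemma polyInner_comm (μ : Measure ℝ) (p q : Polynomial ℝ) : polyInner μ p q = polyInner μ q p := by
  simp only [polyInner, mul_comm]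

lemma polyInner_X_mul (μ : Measure ℝ) (p q : Polynomial ℝ) :
    polyInner μ (Polynomial.X * p) q = polyInner μ p (Polynomial.X * q) := by
  simp only [polyInner, Polynomial.eval_mul]
  congr 1
  ext x
  ring

lemma polyInner_self_nonneg (μ : Measure ℝ) (p : Polynomial ℝ) : 0 ≤ polyInner μ p p :=
  integral_nonneg fun x => mul_self_nonneg (p.eval x)

/-- All polynomials are integrable with respect to `μ`. -/
def FiniteMoments (μ : Measure ℝ) : Prop :=
  ∀ p : Polynomial ℝ, Integrable (fun x => p.eval x) μ

/-- `polyInner` as a bilinear form, for a measure with finite moments. -/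
noncomputable def polyForm {μ : Measure ℝ}
    (hint : FiniteMoments μ) :
    Polynomial ℝ →ₗ[ℝ] Polynomial ℝ →ₗ[ℝ] ℝ :=
  have hi : ∀ p q : Polynomial ℝ, Integrable (fun x => p.eval x * q.eval x) μ := fun p q => by
    simpa only [Polynomial.eval_mul] using hint (p * q)
  LinearMap.mk₂ ℝ (polyInner μ)
    (fun p q g => by
      simp only [polyInner, Polynomial.eval_add, add_mul]
      exact integral_add (hi _ _) (hi _ _))
    (fun c p g => by
      simp only [polyInner, Polynomial.eval_smul, smul_eq_mul, mul_assoc]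
      exact integral_const_mul _ _)
    (fun p q g => by
      simp only [polyInner, Polynomial.eval_add, mul_add]
      exact integral_add (hi _ _) (hi _ _))
    (fun c p g => by
      simp only [polyInner, Polynomial.eval_smul, smul_eq_mul, mul_left_comm _ c]
      exact integral_const_mul _ _)

lemma polyForm_apply {μ : Measure ℝ}
    (hint : FiniteMoments μ) (p q : Polynomial ℝ) :
    polyForm hint p q = polyInner μ p q := rfl

/-- A polynomial of norm zero vanishes almost everywhere. This keeps the expansions valid once the
Gram–Schmidt sequence has terminated and `orthoPoly` is 0. -/
lemma polyInner_eq_zero_of_self {μ : Measure ℝ}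
    (hint : FiniteMoments μ) {p : Polynomial ℝ}
    (h : polyInner μ p p = 0) (q : Polynomial ℝ) : polyInner μ p q = 0 := by
  have hi : Integrable (fun x => p.eval x * p.eval x) μ := by
    simpa only [Polynomial.eval_mul] using hint (p * p)
  have := (integral_eq_zero_iff_of_nonneg (fun x => mul_self_nonneg (p.eval x)) hi).1 h
  refine integral_eq_zero_of_ae ?_
  filter_upwards [this] with x hx
  have : p.eval x = 0 := by simpa using hx
  simp [this]

/-- The residual of `X ^ n` in the Gram–Schmidt process. -/
noncomputable def orthoResidual (μ : Measure ℝ) (n : ℕ) : Polynomial ℝ :=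
  Polynomial.X ^ n -
    ∑ j ∈ Finset.range n, polyInner μ (Polynomial.X ^ n) (orthoPoly μ j) • orthoPoly μ j

lemma orthoPoly_eq (μ : Measure ℝ) (n : ℕ) :
    orthoPoly μ n =
      (Real.sqrt (polyInner μ (orthoResidual μ n) (orthoResidual μ n)))⁻¹ • orthoResidual μ n := by
  rw [orthoPoly]
  simp only [orthoResidual, Finset.sum_range]

lemma orthoPoly_degree_lt (μ : Measure ℝ) (n : ℕ) : (orthoPoly μ n).degree < (n + 1 : ℕ) := by
  induction n using Nat.strong_induction_on with
  | _ n ih =>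
    rw [orthoPoly_eq, ← Polynomial.mem_degreeLT]
    refine Submodule.smul_mem _ _ (Submodule.sub_mem _ ?_ (Submodule.sum_mem _ fun j hj => ?_))
    · rw [Polynomial.mem_degreeLT, Polynomial.degree_X_pow]
      exact_mod_cast Nat.lt_succ_self n
    · refine Submodule.smul_mem _ _ ?_
      rw [Finset.mem_range] at hj
      rw [Polynomial.mem_degreeLT]
      exact (ih j hj).trans (by exact_mod_cast Nat.succ_lt_succ hj)

lemma orthoPoly_self (μ : Measure ℝ) (n : ℕ) :
    polyInner μ (orthoPoly μ n) (orthoPoly μ n) = 1 ∨ orthoPoly μ n = 0 := by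
  set r := orthoResidual μ n with hr
  rcases (polyInner_self_nonneg μ r).eq_or_lt with h | h
  · right
    rw [orthoPoly_eq, ← hr, ← h]
    simp
  · left
    have : polyInner μ (orthoPoly μ n) (orthoPoly μ n)
        = (Real.sqrt (polyInner μ r r))⁻¹ ^ 2 * polyInner μ r r := by
      rw [orthoPoly_eq, ← hr]
      simp only [polyInner, Polynomial.eval_smul, smul_eq_mul]
      rw [← integral_const_mul]
      congr 1
      ext x
      ring
    rw [this, inv_pow, Real.sq_sqrt h.le, inv_mul_cancel₀ h.ne']

/-- Orthogonality of the earlier polynomials is a hypothesis, so that the lemma can be used inside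
the induction proving it. -/
lemma polyInner_orthoResidual {μ : Measure ℝ} (hint : FiniteMoments μ) {n j : ℕ} (hj : j < n)
    (horth : ∀ i < n, i ≠ j → polyInner μ (orthoPoly μ i) (orthoPoly μ j) = 0) :
    polyInner μ (orthoResidual μ n) (orthoPoly μ j) = 0 := by
  have hB := polyForm_apply hint
  rw [← hB, orthoResidual, map_sub, map_sum, LinearMap.sub_apply, LinearMap.sum_apply,
    Finset.sum_eq_single j]
  · rw [map_smul, LinearMap.smul_apply, smul_eq_mul, hB, hB]
    rcases orthoPoly_self μ j with h | h
    · rw [h]; ring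
    · simp [h, polyInner]
  · intro i hi hij
    rw [map_smul, LinearMap.smul_apply, smul_eq_mul, hB, horth i (Finset.mem_range.1 hi) hij,
      mul_zero]
  · intro h
    exact absurd (Finset.mem_range.2 hj) h

lemma polyInner_orthoPoly_of_lt {μ : Measure ℝ} (hint : FiniteMoments μ) (n : ℕ) :
    ∀ j < n, polyInner μ (orthoPoly μ n) (orthoPoly μ j) = 0 := by
  have hB := polyForm_apply hint
  induction n using Nat.strong_induction_on with
  | _ n ih =>
    intro j hj
    rw [orthoPoly_eq, ← hB, map_smul, LinearMap.smul_apply, hB, polyInner_orthoResidual hint hj,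
      smul_zero]
    intro i hi hij
    rcases lt_or_gt_of_ne hij with h | h
    · rw [polyInner_comm, ih j hj i h]
    · exact ih i hi j h

lemma polyInner_orthoPoly_of_ne {μ : Measure ℝ} (hint : FiniteMoments μ) {i j : ℕ} (hij : i ≠ j) :
    polyInner μ (orthoPoly μ i) (orthoPoly μ j) = 0 := by
  rcases lt_or_gt_of_ne hij with h | h
  · rw [polyInner_comm, polyInner_orthoPoly_of_lt hint j i h]
  · exact polyInner_orthoPoly_of_lt hint i j h

/-- The orthonormal expansion of a polynomial of degree less than `n`, in Parseval form. -/
lemma polyInner_eq_sum {μ : Measure ℝ} (hint : FiniteMoments μ) (n : ℕ) : ∀ f : Polynomial ℝ,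
    f.degree < n → ∀ g,
    polyInner μ f g = ∑ j ∈ Finset.range n,
      polyInner μ f (orthoPoly μ j) * polyInner μ (orthoPoly μ j) g := by
  have hB := polyForm_apply hint
  induction n with
  | zero =>
    intro f hf g
    have : f = 0 := by
      rw [← Polynomial.degree_eq_bot]
      exact Nat.WithBot.lt_zero_iff.1 (by simpa using hf)
    simp [this, polyInner]
  | succ n ih =>
    intro f hf g
    set r := orthoResidual μ n with hr
    -- The residual is monic of degree `n`, so subtracting this multiple removes the top coefficient
    -- and the induction hypothesis applies.
    set f' := f - f.coeff n • r with hf'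
    have hdeg : f'.degree < n := by
      have e : f' = (f - f.coeff n • Polynomial.X ^ n) + f.coeff n • ∑ j ∈ Finset.range n,
          polyInner μ (Polynomial.X ^ n) (orthoPoly μ j) • orthoPoly μ j := by
        rw [hf', hr, orthoResidual, smul_sub]
        ring
      rw [e, ← Polynomial.mem_degreeLT]
      refine Submodule.add_mem _ ?_ (Submodule.smul_mem _ _ (Submodule.sum_mem _ fun j hj =>
        Submodule.smul_mem _ _ ?_))
      · rw [Polynomial.mem_degreeLT, Polynomial.degree_lt_iff_coeff_zero]
        intro m hm
        rw [Polynomial.coeff_sub, Polynomial.coeff_smul, Polynomial.coeff_X_pow]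
        by_cases hmn : m = n
        · simp [hmn]
        · rw [Polynomial.degree_lt_iff_coeff_zero] at hf
          rw [hf m (by omega)]
          simp [hmn]
      · rw [Finset.mem_range] at hj
        rw [Polynomial.mem_degreeLT]
        exact (orthoPoly_degree_lt μ j).trans_le (by exact_mod_cast hj)
    have hff : f = f.coeff n • r + f' := by rw [hf']; ring
    have hlin : ∀ h, polyInner μ f h = f.coeff n * polyInner μ r h + polyInner μ f' h := by
      intro h
      have e := congrArg (fun q => polyForm hint q h) hff
      simpa only [map_add, map_smul, LinearMap.add_apply, LinearMap.smul_apply, hB,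
        smul_eq_mul] using e
    have h0 : polyInner μ f' (orthoPoly μ n) = 0 := by
      rw [ih f' hdeg]
      refine Finset.sum_eq_zero fun j hj => ?_
      rw [polyInner_orthoPoly_of_ne hint (Finset.mem_range.1 hj).ne, mul_zero]
    have hrj : ∀ j < n, polyInner μ r (orthoPoly μ j) = 0 := fun j hj =>
      polyInner_orthoResidual hint hj fun i _ hij => polyInner_orthoPoly_of_ne hint hij
    have hrn : polyInner μ r g
        = polyInner μ r (orthoPoly μ n) * polyInner μ (orthoPoly μ n) g := by
      rcases (polyInner_self_nonneg μ r).eq_or_lt with h | h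
      · rw [polyInner_eq_zero_of_self hint h.symm, polyInner_eq_zero_of_self hint h.symm, zero_mul]
      · have e1 : ∀ c : ℝ, polyInner μ r (c • r) = c * polyInner μ r r := fun c => by
          rw [← hB, map_smul, hB, smul_eq_mul]
        have e2 : ∀ c : ℝ, polyInner μ (c • r) g = c * polyInner μ r g := fun c => by
          rw [← hB, map_smul, LinearMap.smul_apply, hB, smul_eq_mul]
        rw [orthoPoly_eq, ← hr, e1, e2]
        have hs := Real.sqrt_pos.2 h
        have hss := Real.mul_self_sqrt h.le
        set s := Real.sqrt (polyInner μ r r)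
        rw [← hss]
        field_simp
    rw [Finset.sum_range_succ, hlin g, hlin (orthoPoly μ n), h0, add_zero, mul_assoc, ← hrn,
      ih f' hdeg g, add_comm]
    congr 1
    refine Finset.sum_congr rfl fun j hj => ?_
    rw [hlin, hrj j (Finset.mem_range.1 hj)]
    ring

lemma polyInner_orthoPoly_of_degree_lt {μ : Measure ℝ} (hint : FiniteMoments μ) {f : Polynomial ℝ}
    {n : ℕ} (hf : f.degree < n) :
    polyInner μ f (orthoPoly μ n) = 0 := by
  rw [polyInner_eq_sum hint n f hf]
  refine Finset.sum_eq_zero fun j hj => ?_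
  rw [polyInner_orthoPoly_of_ne hint (Finset.mem_range.1 hj).ne, mul_zero]

/-! ### Jacobi matrices and Gaussian quadrature -/

/-- The Jacobi matrix is the Gram matrix of multiplication by `X`. -/
lemma jacobiMatrix_apply {μ : Measure ℝ} (hint : FiniteMoments μ) {k : ℕ} (i j : Fin k) :
    jacobiMatrix μ k i j = polyInner μ (orthoPoly μ i) (Polynomial.X * orthoPoly μ j) := by
  have hfar : ∀ i j : ℕ, i + 1 < j →
      polyInner μ (Polynomial.X * orthoPoly μ i) (orthoPoly μ j) = 0 := by
    intro i j hij
    refine polyInner_orthoPoly_of_degree_lt hint ?_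
    have h1 := orthoPoly_degree_lt μ i
    rw [Polynomial.degree_lt_iff_coeff_zero] at h1 ⊢
    intro m hm
    obtain ⟨m, rfl⟩ : ∃ m', m = m' + 1 := ⟨m - 1, by omega⟩
    rw [Polynomial.coeff_X_mul]
    exact h1 m (by omega)
  rw [← polyInner_X_mul]
  simp only [jacobiMatrix, Matrix.of_apply]
  split_ifs with h1 h2 h3
  · rw [h1, recAlpha]
  · rw [recBeta, h2]
  · rw [recBeta, h3, polyInner_X_mul, polyInner_comm]
  · have hij : (i : ℕ) ≠ j := fun h => h1 (Fin.ext h)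
    rcases lt_or_gt_of_ne hij with h | h
    · exact (hfar i j (by omega)).symm
    · rw [polyInner_X_mul, polyInner_comm]
      exact (hfar j i (by omega)).symm

/-- With `q = ∑ vᵢ pᵢ`, the identity `X q = θ q` may fail in the direction of `p_k`, but a test
polynomial of degree less than `k` does not see that direction. -/
lemma polyInner_X_mul_eigenvector {μ : Measure ℝ} (hint : FiniteMoments μ) {k : ℕ} {v : Fin k → ℝ}
    {θ : ℝ}
    (hv : (jacobiMatrix μ k).mulVec v = θ • v) {f : Polynomial ℝ} (hf : f.degree < k) :
    polyInner μ f (Polynomial.X * ∑ i, v i • orthoPoly μ i)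
      = θ * polyInner μ f (∑ i, v i • orthoPoly μ i) := by
  have hB := polyForm_apply hint
  have hv' : ∀ i, ∑ j, jacobiMatrix μ k i j * v j = θ * v i := fun i => congrFun hv i
  rw [polyInner_eq_sum hint k f hf, Finset.sum_range, ← hB f (∑ i, v i • _), map_sum,
    Finset.mul_sum _ _ θ]
  refine Finset.sum_congr rfl fun l _ => ?_
  rw [map_smul, smul_eq_mul, hB, ← mul_assoc, ← hv', mul_comm]
  congr 1
  rw [← hB (orthoPoly μ l), Finset.mul_sum, map_sum]
  refine Finset.sum_congr rfl fun j _ => ?_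
  rw [jacobiMatrix_apply hint, mul_smul_comm, map_smul, hB, smul_eq_mul, mul_comm]

lemma orthoPoly_zero {μ : Measure ℝ} [IsProbabilityMeasure μ] : orthoPoly μ 0 = 1 := by
  rw [orthoPoly_eq]
  simp [orthoResidual, polyInner]

lemma polyInner_one_eigenvector {μ : Measure ℝ} (hint : FiniteMoments μ) [IsProbabilityMeasure μ]
    {k : ℕ} (v : Fin k → ℝ) (hk : 0 < k) :
    polyInner μ 1 (∑ i, v i • orthoPoly μ i) = v ⟨0, hk⟩ := by
  have hB := polyForm_apply hint
  rw [← hB, map_sum, Finset.sum_eq_single ⟨0, hk⟩]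
  · rw [map_smul, hB, orthoPoly_zero]
    simp [polyInner]
  · intro i _ hi
    have : (0 : ℕ) ≠ i := fun h => hi (Fin.ext h.symm)
    rw [map_smul, hB, ← orthoPoly_zero (μ := μ), polyInner_orthoPoly_of_ne hint this, smul_zero]
  · simp

/-- Moving one factor `X` at a time across the form multiplies by `θ`, starting from `⟨1, q⟩ = v₀`.
-/
lemma polyInner_eigenvector {μ : Measure ℝ} (hint : FiniteMoments μ) [IsProbabilityMeasure μ]
    {k : ℕ} {v : Fin k → ℝ} {θ : ℝ}
    (hv : (jacobiMatrix μ k).mulVec v = θ • v) (hk : 0 < k) {f : Polynomial ℝ}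
    (hf : f.natDegree < k) :
    polyInner μ f (∑ i, v i • orthoPoly μ i) = f.eval θ * v ⟨0, hk⟩ := by
  have hB := polyForm_apply hint
  have hpow : ∀ j < k, polyInner μ (Polynomial.X ^ j) (∑ i, v i • orthoPoly μ i)
      = θ ^ j * v ⟨0, hk⟩ := by
    intro j
    induction j with
    | zero => intro _; simpa using polyInner_one_eigenvector hint v hk
    | succ j ih =>
      intro hj
      rw [pow_succ', polyInner_X_mul, polyInner_X_mul_eigenvector hint hv, ih (by omega)]
      · ring
      · rw [Polynomial.degree_X_pow]
        exact_mod_cast (by omega : j < k)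
  rw [Polynomial.eval_eq_sum_range' hf, ← hB]
  conv_lhs => rw [f.as_sum_range' k hf]
  rw [map_sum (polyForm hint), LinearMap.sum_apply, Finset.sum_mul]
  refine Finset.sum_congr rfl fun j hj => ?_
  rw [← Polynomial.smul_X_eq_monomial, map_smul, LinearMap.smul_apply, hB,
    hpow j (Finset.mem_range.1 hj), smul_eq_mul, mul_assoc]

lemma inner_firstBasisVector {k : ℕ} (hk : 0 < k) (v : EuclideanSpace ℝ (Fin k)) :
    inner ℝ v (firstBasisVector k) = v ⟨0, hk⟩ := by
  rw [PiLp.inner_apply, Finset.sum_eq_single ⟨0, hk⟩]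
  · simp [firstBasisVector]
  · intro i _ hi
    have : ¬ (i : ℕ) = 0 := fun h => hi (Fin.ext h)
    simp [firstBasisVector, this]
  · simp

/-- Gaussian quadrature integrates the polynomials of degree less than `k` exactly. -/
theorem sum_gaussQuadrature_eval {μ : Measure ℝ} (hint : FiniteMoments μ) [IsProbabilityMeasure μ]
    {k : ℕ} {f : Polynomial ℝ}
    (hf : f.natDegree < k) :
    ∑ r, inner ℝ ((jacobiMatrix_isHermitian μ k).eigenvectorBasis r) (firstBasisVector k) ^ 2
      * f.eval ((jacobiMatrix_isHermitian μ k).eigenvalues r) = ∫ x, f.eval x ∂μ := by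
  have hB := polyForm_apply hint
  have hk : 0 < k := by omega
  set hM := jacobiMatrix_isHermitian μ k
  -- The coordinates of `f` in the orthonormal polynomials. Its component along the eigenvector `v`
  -- is `f(θ) v₀`, so Parseval for `⟨e₁, y⟩` in the eigenbasis is the quadrature formula.
  set y : EuclideanSpace ℝ (Fin k) := WithLp.toLp 2 fun i => polyInner μ f (orthoPoly μ i) with hy
  have h1 : ∀ r, inner ℝ (hM.eigenvectorBasis r) y
      = f.eval (hM.eigenvalues r) * inner ℝ (hM.eigenvectorBasis r) (firstBasisVector k) := by
    intro r
    rw [inner_firstBasisVector hk, ← polyInner_eigenvector hint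
      (hM.mulVec_eigenvectorBasis r) hk hf, ← hB, map_sum, PiLp.inner_apply]
    refine Finset.sum_congr rfl fun i _ => ?_
    rw [map_smul, hB, hy]
    simp [mul_comm]
  have h2 := hM.eigenvectorBasis.sum_inner_mul_inner (firstBasisVector k) y
  rw [real_inner_comm y, inner_firstBasisVector hk y] at h2
  have h3 : y ⟨0, hk⟩ = ∫ x, f.eval x ∂μ := by
    simp [hy, orthoPoly_zero, polyInner]
  rw [← h3, ← h2]
  refine Finset.sum_congr rfl fun r _ => ?_
  rw [h1, real_inner_comm]
  ring

/-- The nodes of Gaussian quadrature of nonzero weight lie in any interval that carries `μ`. -/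
theorem gaussQuadrature_node_mem {μ : Measure ℝ} (hint : FiniteMoments μ) [IsProbabilityMeasure μ]
    {k : ℕ} {a b : ℝ}
    (hab : ∀ᵐ x ∂μ, x ∈ Set.Icc a b) (r : Fin k)
    (hr : inner ℝ ((jacobiMatrix_isHermitian μ k).eigenvectorBasis r) (firstBasisVector k) ≠ 0) :
    (jacobiMatrix_isHermitian μ k).eigenvalues r ∈ Set.Icc a b := by
  have hk : 0 < k := r.pos
  set hM := jacobiMatrix_isHermitian μ k
  set θ := hM.eigenvalues r
  set v : Fin k → ℝ := (hM.eigenvectorBasis r).ofLp with hvdef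
  set q : Polynomial ℝ := ∑ i, v i • orthoPoly μ i with hq
  rw [inner_firstBasisVector hk] at hr
  have hqdeg : q.degree < k := by
    rw [← Polynomial.mem_degreeLT]
    refine Submodule.sum_mem _ fun i _ => Submodule.smul_mem _ _ ?_
    rw [Polynomial.mem_degreeLT]
    exact (orthoPoly_degree_lt μ i).trans_le (by exact_mod_cast i.isLt)
  have hX : polyInner μ q (Polynomial.X * q) = θ * polyInner μ q q :=
    polyInner_X_mul_eigenvector hint (hM.mulVec_eigenvectorBasis r) hqdeg
  -- Nonzero weight means `⟨1, q⟩ ≠ 0`, so `q` is not null and `θ` is the Rayleigh quotient of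
  -- multiplication by `x`. Eigenvectors from the zero padding have `q = 0` and are excluded here.
  have hpos : 0 < polyInner μ q q := by
    refine (polyInner_self_nonneg μ q).lt_of_ne' fun h => hr ?_
    have := polyInner_eq_zero_of_self hint h 1
    rwa [polyInner_comm, polyInner_one_eigenvector hint v hk] at this
  have hi1 : Integrable (fun x => q.eval x * (Polynomial.X * q).eval x) μ := by
    exact (hint (q * (Polynomial.X * q))).congr
      (Filter.Eventually.of_forall fun x => Polynomial.eval_mul)
  have hi2 : Integrable (fun x => q.eval x * q.eval x) μ := by
    simpa only [Polynomial.eval_mul] using hint (q * q)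
  constructor
  · have : a * polyInner μ q q ≤ θ * polyInner μ q q := by
      rw [← hX, polyInner, polyInner, ← integral_const_mul]
      refine integral_mono_ae (hi2.const_mul a) hi1 ?_
      filter_upwards [hab] with x hx
      simp only [Polynomial.eval_mul, Polynomial.eval_X]
      nlinarith [mul_self_nonneg (q.eval x), hx.1]
    exact le_of_mul_le_mul_right this hpos
  · have : θ * polyInner μ q q ≤ b * polyInner μ q q := by
      rw [← hX, polyInner, polyInner, ← integral_const_mul]
      refine integral_mono_ae hi1 (hi2.const_mul b) ?_
      filter_upwards [hab] with x hx
      simp only [Polynomial.eval_mul, Polynomial.eval_X]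
      nlinarith [mul_self_nonneg (q.eval x), hx.2]
    exact le_of_mul_le_mul_right this hpos

/-! ### Quadratic forms of a uniform point on the sphere -/

lemma lintegral_polar {d : ℕ} (hd : 1 ≤ d) {F : EuclideanSpace ℝ (Fin d) → ℝ≥0∞}
    (hF : Measurable F) :
    ∫⁻ x, F x = ∫⁻ y : Metric.sphere (0 : EuclideanSpace ℝ (Fin d)) 1,
      ∫⁻ r in Set.Ioi (0 : ℝ), ENNReal.ofReal (r ^ (d - 1)) * F (r • (y : EuclideanSpace ℝ (Fin d)))
        ∂volume ∂(volume : Measure (EuclideanSpace ℝ (Fin d))).toSphere := by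
  have : Nonempty (Fin d) := ⟨⟨0, hd⟩⟩
  have hmp :=
    (volume : Measure (EuclideanSpace ℝ (Fin d))).measurePreserving_homeomorphUnitSphereProd
  have hG : Measurable fun p : Metric.sphere (0 : EuclideanSpace ℝ (Fin d)) 1 × Set.Ioi (0 : ℝ) =>
      F ((p.2 : ℝ) • (p.1 : EuclideanSpace ℝ (Fin d))) := by
    refine hF.comp ?_
    fun_prop
  calc ∫⁻ x, F x = ∫⁻ x : ({(0)}ᶜ : Set (EuclideanSpace ℝ (Fin d))), F x.1
        ∂((volume : Measure (EuclideanSpace ℝ (Fin d))).comap Subtype.val) := by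
        rw [lintegral_subtype_comap (measurableSet_singleton _).compl, restrict_compl_singleton]
    _ = ∫⁻ p, F ((p.2 : ℝ) • (p.1 : EuclideanSpace ℝ (Fin d)))
        ∂((volume : Measure (EuclideanSpace ℝ (Fin d))).toSphere.prod
          (.volumeIoiPow (Module.finrank ℝ (EuclideanSpace ℝ (Fin d)) - 1))) := by
        rw [← hmp.lintegral_comp hG]
        refine lintegral_congr fun x => ?_
        have hx : ‖(x : EuclideanSpace ℝ (Fin d))‖ ≠ 0 := norm_ne_zero_iff.2 x.2
        congr 1
        simp [smul_smul, mul_inv_cancel₀ hx]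
    _ = _ := by
        rw [lintegral_prod _ hG.aemeasurable]
        refine lintegral_congr fun y => ?_
        have hGy : Measurable fun r : Set.Ioi (0 : ℝ) =>
            F ((r : ℝ) • (y : EuclideanSpace ℝ (Fin d))) := hG.comp measurable_prodMk_left
        rw [Measure.volumeIoiPow, lintegral_withDensity_eq_lintegral_mul _ (by fun_prop) hGy,
          finrank_euclideanSpace_fin]
        exact lintegral_subtype_comap measurableSet_Ioi fun r =>
          ENNReal.ofReal (r ^ (d - 1)) * F (r • (y : EuclideanSpace ℝ (Fin d)))

lemma lintegral_radial_gaussian {d : ℕ} (hd : 1 ≤ d) {c : ℝ} (hc : 0 < c) :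
    ∫⁻ r in Set.Ioi (0 : ℝ), ENNReal.ofReal (r ^ (d - 1)) * ENNReal.ofReal (Real.exp (-c * r ^ 2))
      = ENNReal.ofReal (c ^ (-(d : ℝ) / 2)) * ENNReal.ofReal (Real.Gamma (d / 2) / 2) := by
  have hcast : ((d - 1 : ℕ) : ℝ) + 1 = d := by
    rw [Nat.cast_sub hd]
    simp
  have h := integral_rpow_mul_exp_neg_mul_rpow (p := 2) (q := ((d - 1 : ℕ) : ℝ)) two_pos
    (by linarith [Nat.cast_nonneg (α := ℝ) (d - 1)]) hc
  rw [hcast] at h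
  have hi : IntegrableOn (fun x : ℝ => x ^ (((d - 1 : ℕ) : ℝ)) * Real.exp (-c * x ^ (2 : ℝ)))
      (Set.Ioi 0) := integrableOn_rpow_mul_exp_neg_mul_rpow
        (by linarith [Nat.cast_nonneg (α := ℝ) (d - 1)]) (by norm_num) hc
  rw [← ENNReal.ofReal_mul (Real.rpow_nonneg hc.le _),
    show c ^ (-(d : ℝ) / 2) * (Real.Gamma (d / 2) / 2)
      = c ^ (-(d : ℝ) / 2) * (1 / 2) * Real.Gamma (d / 2) by ring, ← h,
    ofReal_integral_eq_lintegral_ofReal hi]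
  · refine setLIntegral_congr_fun measurableSet_Ioi fun r hr => ?_
    have hr' : (0 : ℝ) ≤ r := le_of_lt hr
    simp only [Real.rpow_natCast, Real.rpow_two]
    rw [ENNReal.ofReal_mul (by positivity)]
  · refine (ae_restrict_iff' measurableSet_Ioi).2 (Filter.Eventually.of_forall fun r hr => ?_)
    have hr' : (0 : ℝ) ≤ r := le_of_lt hr
    simp only [Pi.zero_apply]
    positivity

lemma lintegral_gaussian_quadratic {d : ℕ} (u : OrthonormalBasis (Fin d)
    ℝ (EuclideanSpace ℝ (Fin d)))
    {c : Fin d → ℝ} (hc : ∀ i, 0 < c i) :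
    ∫⁻ x : EuclideanSpace ℝ (Fin d), ENNReal.ofReal (Real.exp (-∑ i, c i * inner ℝ (u i) x ^ 2))
      = ENNReal.ofReal (∏ i, Real.sqrt (Real.pi / c i)) := by
  have h1 : ∫⁻ x : EuclideanSpace ℝ (Fin d),
        ENNReal.ofReal (Real.exp (-∑ i, c i * inner ℝ (u i) x ^ 2))
      = ∫⁻ x : Fin d → ℝ, ENNReal.ofReal (∏ i, Real.exp (-c i * x i ^ 2)) := by
    rw [← ((PiLp.volume_preserving_ofLp (Fin d)).comp u.measurePreserving_repr).lintegral_comp]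
    · refine lintegral_congr fun x => ?_
      rw [← Real.exp_sum]
      simp [u.repr_apply_apply, Finset.sum_neg_distrib]
    · fun_prop
  rw [h1, ← ofReal_integral_eq_lintegral_ofReal]
  · congr 1
    rw [volume_pi, integral_fintype_prod_eq_prod (fun i t => Real.exp (-c i * t ^ 2))]
    simp only [integral_gaussian]
  · rw [volume_pi]
    exact Integrable.fintype_prod (f := fun i t => Real.exp (-c i * t ^ 2))
      fun i => integrable_exp_neg_mul_sq (hc i)
  · exact Filter.Eventually.of_forall fun x => Finset.prod_nonneg fun i _ => (Real.exp_pos _).le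

lemma sum_sq_inner_eq_one {d : ℕ} (u : OrthonormalBasis (Fin d) ℝ (EuclideanSpace ℝ (Fin d)))
    (y : Metric.sphere (0 : EuclideanSpace ℝ (Fin d)) 1) :
    ∑ i, inner ℝ (u i) (y : EuclideanSpace ℝ (Fin d)) ^ 2 = 1 := by
  have := u.sum_sq_norm_inner_right (y : EuclideanSpace ℝ (Fin d))
  simpa using this

/-- The Gaussian integral of a quadratic form `Q` computed twice: as a product over the coordinates
in the basis `u`, and in polar coordinates, where homogeneity gives `Q(y)^(-d/2)` times a Gamma
factor. -/
lemma toSphere_quadratic {d : ℕ} (hd : 1 ≤ d)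
    (u : OrthonormalBasis (Fin d) ℝ (EuclideanSpace ℝ (Fin d))) {c : Fin d → ℝ}
    (hc : ∀ i, 0 < c i) :
    (∫⁻ y : Metric.sphere (0 : EuclideanSpace ℝ (Fin d)) 1, ENNReal.ofReal
      ((∑ i, c i * inner ℝ (u i) (y : EuclideanSpace ℝ (Fin d)) ^ 2) ^ (-(d : ℝ) / 2))
        ∂(volume : Measure (EuclideanSpace ℝ (Fin d))).toSphere)
      * ENNReal.ofReal (Real.Gamma (d / 2) / 2)
      = ENNReal.ofReal (∏ i, Real.sqrt (Real.pi / c i)) := by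
  rw [← lintegral_gaussian_quadratic u hc, lintegral_polar hd (by fun_prop),
    ← lintegral_mul_const' _ _ ENNReal.ofReal_ne_top]
  refine lintegral_congr fun y => ?_
  have hpos : 0 < ∑ i, c i * inner ℝ (u i) (y : EuclideanSpace ℝ (Fin d)) ^ 2 := by
    have h1 := sum_sq_inner_eq_one u y
    obtain ⟨i, -, hi⟩ : ∃ i ∈ Finset.univ, inner ℝ (u i) (y : EuclideanSpace ℝ (Fin d)) ^ 2 ≠ 0 :=
      Finset.exists_ne_zero_of_sum_ne_zero (by rw [h1]; exact one_ne_zero)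
    exact Finset.sum_pos' (fun j _ => mul_nonneg (hc j).le (sq_nonneg _))
      ⟨i, Finset.mem_univ _, mul_pos (hc i) (lt_of_le_of_ne (sq_nonneg _) hi.symm)⟩
  rw [← lintegral_radial_gaussian hd hpos]
  refine lintegral_congr fun r => ?_
  congr 3
  rw [neg_mul, Finset.sum_mul]
  congr 1
  refine Finset.sum_congr rfl fun i _ => ?_
  rw [inner_smul_right]
  ring

/-- The expectation of a power of a diagonal quadratic form of a uniform point on the sphere. -/
theorem sphereUniform_quadratic {d : ℕ} (hd : 1 ≤ d)
    (u : OrthonormalBasis (Fin d) ℝ (EuclideanSpace ℝ (Fin d))) {c : Fin d → ℝ}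
    (hc : ∀ i, 0 < c i) :
    ∫⁻ y : Metric.sphere (0 : EuclideanSpace ℝ (Fin d)) 1, ENNReal.ofReal
      ((∑ i, c i * inner ℝ (u i) (y : EuclideanSpace ℝ (Fin d)) ^ 2) ^ (-(d : ℝ) / 2))
        ∂(sphereUniform d)
      = ENNReal.ofReal (∏ i, Real.sqrt (1 / c i)) := by
  have : Nonempty (Fin d) := ⟨⟨0, hd⟩⟩
  have hG : ENNReal.ofReal (Real.Gamma (d / 2) / 2) ≠ 0 := by
    have : (0 : ℝ) < d := by exact_mod_cast hd
    have := Real.Gamma_pos_of_pos (half_pos this)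
    rw [Ne, ENNReal.ofReal_eq_zero, not_le]
    positivity
  -- The case `Q = 1` on the sphere gives the total surface measure, which normalizes the formula.
  have h0 := toSphere_quadratic hd u (c := fun _ => 1) fun _ => one_pos
  simp only [one_mul, sum_sq_inner_eq_one, Real.one_rpow, ENNReal.ofReal_one, lintegral_one,
    div_one] at h0
  have h := toSphere_quadratic hd u hc
  have hprod : ∏ i, Real.sqrt (Real.pi / c i)
      = (∏ _i : Fin d, Real.sqrt Real.pi) * ∏ i, Real.sqrt (1 / c i) := by
    rw [← Finset.prod_mul_distrib]
    refine Finset.prod_congr rfl fun i _ => ?_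
    rw [← Real.sqrt_mul Real.pi_pos.le, mul_one_div]
  rw [hprod, ENNReal.ofReal_mul (Finset.prod_nonneg fun i _ => Real.sqrt_nonneg _), ← h0,
    mul_right_comm] at h
  have h' := (ENNReal.mul_left_inj hG ENNReal.ofReal_ne_top).1 h
  rw [sphereUniform, lintegral_smul_measure, h', smul_eq_mul, ← mul_assoc,
    ENNReal.inv_mul_cancel, one_mul]
  · rw [Ne, Measure.measure_univ_eq_zero]
    exact Measure.toSphere_ne_zero _
  · exact measure_ne_top _ _

instance isProbabilityMeasure_sphereUniform (d : ℕ) [NeZero d] :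
    IsProbabilityMeasure (sphereUniform d) := by
  have : Nonempty (Fin d) := ⟨0⟩
  constructor
  rw [sphereUniform, Measure.smul_apply, smul_eq_mul, ENNReal.inv_mul_cancel]
  · rw [Ne, Measure.measure_univ_eq_zero]
    exact Measure.toSphere_ne_zero _
  · exact measure_ne_top _ _

/-- After squaring, the claim is `1 ≤ exp(2η + 4η²)(1 - 2η)`. For `η < 0` the linear bound on `exp`
suffices, as `(1 + 2η + 4η²)(1 - 2η) = 1 - 8η³`; for `η ≥ 0` the quadratic term is needed. -/
lemma sqrt_one_div_le_exp {η : ℝ} (hη : |η| ≤ 1 / 4) :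
    Real.sqrt (1 / (1 - 2 * η)) ≤ Real.exp (η + 2 * η ^ 2) := by
  obtain ⟨h1, h2⟩ := abs_le.1 hη
  rw [Real.sqrt_le_left (Real.exp_pos _).le, ← Real.exp_nat_mul, div_le_iff₀ (by linarith)]
  push_cast
  rcases le_or_gt 0 η with h | h
  · have h3 := Real.quadratic_le_exp_of_nonneg (x := 2 * (η + 2 * η ^ 2)) (by positivity)
    have h4 := mul_le_mul_of_nonneg_right h3 (by linarith : 0 ≤ 1 - 2 * η)
    refine le_trans ?_ h4
    have : (1 + 2 * (η + 2 * η ^ 2) + (2 * (η + 2 * η ^ 2)) ^ 2 / 2) * (1 - 2 * η) - 1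
        = η ^ 2 * (2 - 4 * η - 8 * η ^ 2 - 16 * η ^ 3) := by ring
    have : 0 ≤ 2 - 4 * η - 8 * η ^ 2 - 16 * η ^ 3 := by
      nlinarith [mul_nonneg h h, pow_le_pow_left₀ h h2 3]
    have := mul_nonneg (sq_nonneg η) this
    linarith
  · have h3 := Real.add_one_le_exp (2 * (η + 2 * η ^ 2))
    have h4 := mul_le_mul_of_nonneg_right h3 (by linarith : 0 ≤ 1 - 2 * η)
    refine le_trans ?_ h4
    nlinarith [mul_nonneg (neg_nonneg.2 h.le) (sq_nonneg η)]

/-- Sub-Gaussian moment generating function of the squared norm of the projection of a uniform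
point on the sphere onto a coordinate subspace. -/
theorem lintegral_exp_sphereUniform_le {d : ℕ} (hd : 1 ≤ d)
    (u : OrthonormalBasis (Fin d) ℝ (EuclideanSpace ℝ (Fin d))) (S : Finset (Fin d)) (t : ℝ) :
    ∫⁻ y : Metric.sphere (0 : EuclideanSpace ℝ (Fin d)) 1, ENNReal.ofReal
      (Real.exp (t * ∑ i ∈ S, (inner ℝ (u i) (y : EuclideanSpace ℝ (Fin d)) ^ 2 - 1 / d)))
        ∂(sphereUniform d)
      ≤ ENNReal.ofReal (Real.exp (4 * t ^ 2 / d)) := by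
  have : NeZero d := ⟨by omega⟩
  have hd0 : (0 : ℝ) < d := by exact_mod_cast hd
  have hSd : (S.card : ℝ) ≤ d := by
    have := S.card_le_univ
    rw [Fintype.card_fin] at this
    exact_mod_cast this
  have hsum : ∀ y : EuclideanSpace ℝ (Fin d), ∑ i ∈ S, (inner ℝ (u i) y ^ 2 - 1 / (d : ℝ))
      = ∑ i ∈ S, inner ℝ (u i) y ^ 2 - S.card / d := by
    intro y
    rw [Finset.sum_sub_distrib, Finset.sum_const, nsmul_eq_mul, mul_one_div]
  have hY : ∀ y : Metric.sphere (0 : EuclideanSpace ℝ (Fin d)) 1,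
      0 ≤ ∑ i ∈ S, inner ℝ (u i) (y : EuclideanSpace ℝ (Fin d)) ^ 2 ∧
      ∑ i ∈ S, inner ℝ (u i) (y : EuclideanSpace ℝ (Fin d)) ^ 2 ≤ 1 := by
    intro y
    refine ⟨Finset.sum_nonneg fun i _ => sq_nonneg _, ?_⟩
    refine le_of_le_of_eq ?_ (sum_sq_inner_eq_one u y)
    exact Finset.sum_le_univ_sum_of_nonneg fun i => sq_nonneg _
  -- For small `t`, `exp(tY)` is at most `(1 - 2ηY)^(-d/2)` with `η = t/d`, whose mean is known
  -- exactly. For large `t`, the trivial bound `|t|` on the exponent is already below `4t²/d`.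
  rcases le_or_gt |t| (d / 4) with ht | ht
  · set η := t / d with hη
    have hη4 : |η| ≤ 1 / 4 := by
      rw [hη, abs_div, abs_of_pos hd0, div_le_iff₀ hd0]
      linarith
    obtain ⟨h1, h2⟩ := abs_le.1 hη4
    set c : Fin d → ℝ := fun i => if i ∈ S then 1 - 2 * η else 1 with hc
    have hcpos : ∀ i, 0 < c i := by
      intro i
      simp only [hc]
      split_ifs <;> linarith
    have hquad : ∀ y : Metric.sphere (0 : EuclideanSpace ℝ (Fin d)) 1,
        ∑ i, c i * inner ℝ (u i) (y : EuclideanSpace ℝ (Fin d)) ^ 2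
          = 1 - 2 * η * ∑ i ∈ S, inner ℝ (u i) (y : EuclideanSpace ℝ (Fin d)) ^ 2 := by
      intro y
      have e : ∀ i, c i * inner ℝ (u i) (y : EuclideanSpace ℝ (Fin d)) ^ 2
          = inner ℝ (u i) (y : EuclideanSpace ℝ (Fin d)) ^ 2 - 2 * η *
            (if i ∈ S then inner ℝ (u i) (y : EuclideanSpace ℝ (Fin d)) ^ 2 else 0) := by
        intro i
        simp only [hc]
        split_ifs <;> ring
      simp only [e]
      rw [Finset.sum_sub_distrib, sum_sq_inner_eq_one, ← Finset.mul_sum, Finset.sum_ite_mem,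
        Finset.univ_inter]
    have key := sphereUniform_quadratic hd u hcpos
    have hpt : ∀ y : Metric.sphere (0 : EuclideanSpace ℝ (Fin d)) 1,
        ENNReal.ofReal (Real.exp (t * ∑ i ∈ S,
          (inner ℝ (u i) (y : EuclideanSpace ℝ (Fin d)) ^ 2 - 1 / d)))
        ≤ ENNReal.ofReal (Real.exp (-(η * S.card))) * ENNReal.ofReal
          ((∑ i, c i * inner ℝ (u i) (y : EuclideanSpace ℝ (Fin d)) ^ 2) ^ (-(d : ℝ) / 2)) := by
      intro y
      rw [← ENNReal.ofReal_mul (Real.exp_pos _).le, hsum, hquad]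
      refine ENNReal.ofReal_le_ofReal ?_
      obtain ⟨y0, y1⟩ := hY y
      set Y := ∑ i ∈ S, inner ℝ (u i) (y : EuclideanSpace ℝ (Fin d)) ^ 2
      have hb : 0 < 1 - 2 * η * Y := by nlinarith
      have e1 : 1 - 2 * η * Y ≤ Real.exp (-(2 * η * Y)) := by
        have := Real.add_one_le_exp (-(2 * η * Y))
        linarith
      have e2 : Real.exp (-(2 * η * Y)) ^ (-(d : ℝ) / 2) ≤ (1 - 2 * η * Y) ^ (-(d : ℝ) / 2) :=
        Real.rpow_le_rpow_of_nonpos hb e1 (by linarith)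
      rw [← Real.exp_mul] at e2
      have e3 : Real.exp (t * (Y - S.card / d))
          = Real.exp (-(η * S.card)) * Real.exp (-(2 * η * Y) * (-(d : ℝ) / 2)) := by
        rw [← Real.exp_add]
        congr 1
        rw [hη]
        field_simp
        ring
      rw [e3]
      exact mul_le_mul_of_nonneg_left e2 (Real.exp_pos _).le
    refine (lintegral_mono hpt).trans ?_
    rw [lintegral_const_mul' _ _ ENNReal.ofReal_ne_top, key,
      ← ENNReal.ofReal_mul (Real.exp_pos _).le]
    refine ENNReal.ofReal_le_ofReal ?_
    have hprod : ∏ i, Real.sqrt (1 / c i) = Real.sqrt (1 / (1 - 2 * η)) ^ S.card := by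
      rw [← Finset.prod_const, ← Finset.prod_subset (Finset.subset_univ S)]
      · refine Finset.prod_congr rfl fun i hi => ?_
        simp [hc, hi]
      · intro i _ hi
        simp [hc, hi]
    rw [hprod]
    have h3 := pow_le_pow_left₀ (Real.sqrt_nonneg _) (sqrt_one_div_le_exp hη4) S.card
    refine (mul_le_mul_of_nonneg_left h3 (Real.exp_pos _).le).trans ?_
    rw [← Real.exp_nat_mul, ← Real.exp_add]
    refine Real.exp_le_exp.2 ?_
    have h4 : -(η * S.card) + S.card * (η + 2 * η ^ 2) = 2 * η ^ 2 * S.card := by ring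
    have h5 : 4 * t ^ 2 / d = 4 * η ^ 2 * d := by
      rw [hη]
      field_simp
    rw [h4, h5]
    nlinarith [sq_nonneg η, mul_le_mul_of_nonneg_left hSd (sq_nonneg η)]
  · have hpt : ∀ y : Metric.sphere (0 : EuclideanSpace ℝ (Fin d)) 1,
        ENNReal.ofReal (Real.exp (t * ∑ i ∈ S,
          (inner ℝ (u i) (y : EuclideanSpace ℝ (Fin d)) ^ 2 - 1 / d)))
        ≤ ENNReal.ofReal (Real.exp (4 * t ^ 2 / d)) := by
      intro y
      rw [hsum]
      refine ENNReal.ofReal_le_ofReal (Real.exp_le_exp.2 ?_)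
      obtain ⟨y0, y1⟩ := hY y
      set Y := ∑ i ∈ S, inner ℝ (u i) (y : EuclideanSpace ℝ (Fin d)) ^ 2
      have e0 : (0 : ℝ) ≤ S.card / d := by positivity
      have e1 : (S.card : ℝ) / d ≤ 1 := (div_le_one hd0).2 hSd
      have e2 : |Y - S.card / d| ≤ 1 := abs_le.2 ⟨by linarith, by linarith⟩
      have e3 : t * (Y - S.card / d) ≤ |t| := by
        refine (le_abs_self _).trans ?_
        rw [abs_mul]
        exact mul_le_of_le_one_right (abs_nonneg _) e2
      refine e3.trans ?_
      rw [le_div_iff₀ hd0, ← sq_abs]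
      nlinarith [abs_nonneg t]
    refine (lintegral_mono hpt).trans ?_
    simp

lemma hasSubgaussianMGF_sphereUniform {d : ℕ} (hd : 1 ≤ d)
    (u : OrthonormalBasis (Fin d) ℝ (EuclideanSpace ℝ (Fin d))) (S : Finset (Fin d)) :
    HasSubgaussianMGF (fun y : Metric.sphere (0 : EuclideanSpace ℝ (Fin d)) 1 =>
      ∑ i ∈ S, (inner ℝ (u i) (y : EuclideanSpace ℝ (Fin d)) ^ 2 - 1 / (d : ℝ)))
      (8 / d) (sphereUniform d) := by
  have hm : ∀ t : ℝ, Measurable fun y : Metric.sphere (0 : EuclideanSpace ℝ (Fin d)) 1 =>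
      Real.exp (t * ∑ i ∈ S, (inner ℝ (u i) (y : EuclideanSpace ℝ (Fin d)) ^ 2 - 1 / (d : ℝ))) := by
    intro t
    fun_prop
  have hle := lintegral_exp_sphereUniform_le hd u S
  constructor
  · intro t
    refine (lintegral_ofReal_ne_top_iff_integrable (hm t).aestronglyMeasurable
      (Filter.Eventually.of_forall fun y => (Real.exp_pos _).le)).1 ?_
    exact ((hle t).trans_lt ENNReal.ofReal_lt_top).ne
  · intro t
    rw [mgf, integral_eq_lintegral_of_nonneg_ae (Filter.Eventually.of_forall fun y =>
      (Real.exp_pos _).le) (hm t).aestronglyMeasurable]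
    refine (ENNReal.toReal_mono ENNReal.ofReal_ne_top (hle t)).trans (le_of_eq ?_)
    rw [ENNReal.toReal_ofReal (Real.exp_pos _).le]
    push_cast
    congr 1
    ring

/-! ### Concentration of the sampled distribution function -/

section Deviation

variable {Ω : Type*} [MeasurableSpace Ω] {P : Measure Ω} {d m : ℕ}
  {b : Fin m → Ω → Metric.sphere (0 : EuclideanSpace ℝ (Fin d)) 1}

lemma lintegral_exp_mean_le (hd : 1 ≤ d) (hm : 1 ≤ m)
    (u : OrthonormalBasis (Fin d) ℝ (EuclideanSpace ℝ (Fin d)))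
    (hb : ∀ l, HasLaw (b l) (sphereUniform d) P) (hind : iIndepFun b P)
    (S : Finset (Fin d)) (t : ℝ) :
    ∫⁻ ω, ENNReal.ofReal (Real.exp (t * ∑ i ∈ S,
        ((m : ℝ)⁻¹ * ∑ l, inner ℝ (u i) (b l ω : EuclideanSpace ℝ (Fin d)) ^ 2 - 1 / d))) ∂P
      ≤ ENNReal.ofReal (Real.exp (4 * t ^ 2 / (d * m))) := by
  have hm0 : (m : ℝ) ≠ 0 := by
    have : m ≠ 0 := by omega
    exact_mod_cast this
  set g : Metric.sphere (0 : EuclideanSpace ℝ (Fin d)) 1 → ℝ := fun y =>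
    ∑ i ∈ S, (inner ℝ (u i) (y : EuclideanSpace ℝ (Fin d)) ^ 2 - 1 / (d : ℝ)) with hg
  have hgm : Measurable g := by
    simp only [hg]
    fun_prop
  have hsub : ∀ l, HasSubgaussianMGF (g ∘ b l) (8 / d) P := by
    intro l
    refine HasSubgaussianMGF.of_map (hb l).aemeasurable ?_
    rw [(hb l).map_eq]
    exact hasSubgaussianMGF_sphereUniform hd u S
  have hsum := HasSubgaussianMGF.sum_of_iIndepFun (s := Finset.univ)
    (hind.comp (fun _ => g) fun _ => hgm) fun l _ => hsub l
  have hrw : ∀ ω, t * ∑ i ∈ S,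
      ((m : ℝ)⁻¹ * ∑ l, inner ℝ (u i) (b l ω : EuclideanSpace ℝ (Fin d)) ^ 2 - 1 / d)
      = t / m * ∑ l, (g ∘ b l) ω := by
    intro ω
    simp only [hg, Function.comp_apply, Finset.sum_sub_distrib, Finset.sum_const, Finset.card_univ,
      Fintype.card_fin, nsmul_eq_mul, ← Finset.mul_sum]
    rw [Finset.sum_comm]
    field_simp
  simp only [hrw]
  rw [← ofReal_integral_eq_lintegral_ofReal (hsum.integrable_exp_mul _)
    (Filter.Eventually.of_forall fun ω => (Real.exp_pos _).le)]
  refine ENNReal.ofReal_le_ofReal ((hsum.mgf_le (t / m)).trans (le_of_eq ?_))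
  rw [Finset.sum_const, Finset.card_univ, Fintype.card_fin]
  congr 1
  push_cast
  rw [nsmul_eq_mul]
  field_simp
  ring

/-- The difference of the distribution functions of the spectral density with eigenvalues `ev` and
of the mean of the eigenvector densities of the vectors `b`. -/
noncomputable def cdfGap (u : OrthonormalBasis (Fin d) ℝ (EuclideanSpace ℝ (Fin d)))
    (ev : Fin d → ℝ) (b : Fin m → EuclideanSpace ℝ (Fin d)) (x : ℝ) : ℝ :=
  ∑ i, (1 / (d : ℝ) - (m : ℝ)⁻¹ * ∑ l, inner ℝ (u i) (b l) ^ 2) * (if ev i ≤ x then 1 else 0)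

/-- The factor 2 comes from `exp(s|g|) ≤ exp(sg) + exp(-sg)`. -/
lemma lintegral_exp_abs_cdfGap_le (hd : 1 ≤ d) (hm : 1 ≤ m)
    (u : OrthonormalBasis (Fin d) ℝ (EuclideanSpace ℝ (Fin d))) (ev : Fin d → ℝ)
    (hb : ∀ l, HasLaw (b l) (sphereUniform d) P) (hind : iIndepFun b P) (x s : ℝ) :
    ∫⁻ ω, ENNReal.ofReal (Real.exp (s * |cdfGap u ev (fun l => (b l ω :
        EuclideanSpace ℝ (Fin d))) x|)) ∂P
      ≤ ENNReal.ofReal (2 * Real.exp (4 * s ^ 2 / (d * m))) := by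
  have hgap : ∀ ω, cdfGap u ev (fun l => (b l ω : EuclideanSpace ℝ (Fin d))) x
      = -∑ i with ev i ≤ x,
        ((m : ℝ)⁻¹ * ∑ l, inner ℝ (u i) (b l ω : EuclideanSpace ℝ (Fin d)) ^ 2 - 1 / d) := by
    intro ω
    rw [cdfGap, Finset.sum_filter, ← Finset.sum_neg_distrib]
    refine Finset.sum_congr rfl fun i _ => ?_
    split_ifs <;> ring
  have hpt : ∀ ω, ENNReal.ofReal (Real.exp (s * |cdfGap u ev (fun l => (b l ω :
        EuclideanSpace ℝ (Fin d))) x|))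
      ≤ ENNReal.ofReal (Real.exp (s * ∑ i with ev i ≤ x,
        ((m : ℝ)⁻¹ * ∑ l, inner ℝ (u i) (b l ω : EuclideanSpace ℝ (Fin d)) ^ 2 - 1 / d)))
        + ENNReal.ofReal (Real.exp (-s * ∑ i with ev i ≤ x,
        ((m : ℝ)⁻¹ * ∑ l, inner ℝ (u i) (b l ω : EuclideanSpace ℝ (Fin d)) ^ 2 - 1 / d))) := by
    intro ω
    rw [hgap, abs_neg]
    rcases abs_choice (∑ i with ev i ≤ x,
      ((m : ℝ)⁻¹ * ∑ l, inner ℝ (u i) (b l ω : EuclideanSpace ℝ (Fin d)) ^ 2 - 1 / (d : ℝ)))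
      with h | h <;> rw [h]
    · exact le_self_add
    · rw [mul_neg, ← neg_mul]
      exact le_add_self
  refine (lintegral_mono hpt).trans ?_
  rw [lintegral_add_left']
  · refine (add_le_add (lintegral_exp_mean_le hd hm u hb hind _ s)
      (lintegral_exp_mean_le hd hm u hb hind _ (-s))).trans (le_of_eq ?_)
    rw [neg_sq, ← two_mul, ENNReal.ofReal_mul zero_le_two, ENNReal.ofReal_ofNat]
  · have := fun l => (hb l).aemeasurable
    fun_prop

/-- Jensen's inequality for `exp`, from its tangent line at `s t`; terms are arranged so that
nothing is subtracted in `ℝ≥0∞` before the final cancellation of a finite quantity. -/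
lemma mul_exp_le_lintegral_exp {α : Type*} [MeasurableSpace α] {ν : Measure α} [IsFiniteMeasure ν]
    {D : α → ℝ} (hD : Measurable D) (hD0 : ∀ x, 0 ≤ D x) {s t : ℝ} (hs : 0 ≤ s) (ht : 0 ≤ t)
    (h : ν Set.univ * ENNReal.ofReal t ≤ ∫⁻ x, ENNReal.ofReal (D x) ∂ν) :
    ν Set.univ * ENNReal.ofReal (Real.exp (s * t))
      ≤ ∫⁻ x, ENNReal.ofReal (Real.exp (s * D x)) ∂ν := by
  set e := Real.exp (s * t) with he
  have hepos : 0 < e := Real.exp_pos _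
  have hpt : ∀ x, ENNReal.ofReal e + ENNReal.ofReal (e * s) * ENNReal.ofReal (D x)
      ≤ ENNReal.ofReal (Real.exp (s * D x)) + ENNReal.ofReal (e * s) * ENNReal.ofReal t := by
    intro x
    have hes : 0 ≤ e * s := by positivity
    rw [← ENNReal.ofReal_mul hes, ← ENNReal.ofReal_mul hes,
      ← ENNReal.ofReal_add hepos.le (mul_nonneg hes (hD0 x)),
      ← ENNReal.ofReal_add (Real.exp_pos _).le (mul_nonneg hes ht)]
    refine ENNReal.ofReal_le_ofReal ?_
    have h1 := Real.add_one_le_exp (s * D x - s * t)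
    rw [Real.exp_sub, le_div_iff₀ (Real.exp_pos _), ← he] at h1
    linarith
  have hint := lintegral_mono (μ := ν) hpt
  rw [lintegral_add_left measurable_const, lintegral_add_right _ measurable_const,
    lintegral_const_mul _ (by fun_prop), lintegral_const, lintegral_const] at hint
  have h2 : ENNReal.ofReal (e * s) * (ν Set.univ * ENNReal.ofReal t)
      ≤ ENNReal.ofReal (e * s) * ∫⁻ x, ENNReal.ofReal (D x) ∂ν := mul_le_mul_right h _
  have h3 : ν Set.univ * ENNReal.ofReal e
        + ENNReal.ofReal (e * s) * (ν Set.univ * ENNReal.ofReal t)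
      ≤ (∫⁻ x, ENNReal.ofReal (Real.exp (s * D x)) ∂ν)
        + ENNReal.ofReal (e * s) * (ν Set.univ * ENNReal.ofReal t) := by
    calc _ ≤ ν Set.univ * ENNReal.ofReal e
          + ENNReal.ofReal (e * s) * ∫⁻ x, ENNReal.ofReal (D x) ∂ν := by gcongr
      _ ≤ _ := by
        rw [mul_comm (ν Set.univ)]
        refine hint.trans (le_of_eq ?_)
        ring
  refine ENNReal.le_of_add_le_add_right ?_ h3
  exact ENNReal.mul_ne_top ENNReal.ofReal_ne_top
    (ENNReal.mul_ne_top (measure_ne_top _ _) ENNReal.ofReal_ne_top)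

/-- Concentration of the Wasserstein distance between the spectral density and the mean of the
eigenvector densities. -/
theorem measure_lintegral_cdfGap_le [IsProbabilityMeasure P] (hd : 1 ≤ d) (hm : 1 ≤ m)
    (u : OrthonormalBasis (Fin d) ℝ (EuclideanSpace ℝ (Fin d))) (ev : Fin d → ℝ)
    (hb : ∀ l, HasLaw (b l) (sphereUniform d) P) (hind : iIndepFun b P) {a c : ℝ} (hac : a < c)
    {t : ℝ} (ht : 0 ≤ t) :
    P {ω | ENNReal.ofReal ((c - a) * t) < ∫⁻ x in Set.Icc a c,
        ENNReal.ofReal |cdfGap u ev (fun l => (b l ω : EuclideanSpace ℝ (Fin d))) x|}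
      ≤ ENNReal.ofReal (2 * Real.exp (-(t ^ 2 * d * m / 16))) := by
  have hd0 : (0 : ℝ) < d := by exact_mod_cast hd
  have hm0 : (0 : ℝ) < m := by exact_mod_cast hm
  -- Minimizes the Chernoff exponent `4s²/(dm) - st`, with value `-t²dm/16`.
  set s := t * d * m / 8 with hs
  have hs0 : 0 ≤ s := by positivity
  set V := ENNReal.ofReal (c - a) with hV
  have hVvol : (volume.restrict (Set.Icc a c)) Set.univ = V := by simp [hV]
  have hV0 : V ≠ 0 := by
    rw [hV, Ne, ENNReal.ofReal_eq_zero]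
    linarith
  have hVtop : V ≠ ∞ := ENNReal.ofReal_ne_top
  have hstep : ∀ i, Measurable fun x : ℝ => if ev i ≤ x then (1 : ℝ) else 0 := fun i =>
    Measurable.ite measurableSet_Ici measurable_const measurable_const
  set H : Ω → ℝ≥0∞ := fun ω => ∫⁻ x in Set.Icc a c, ENNReal.ofReal (Real.exp (s *
    |cdfGap u ev (fun l => (b l ω : EuclideanSpace ℝ (Fin d))) x|)) with hH
  -- A large average of the gap over `[a, c]` forces, by Jensen, a large average of its exponential,
  -- whose expectation is accessible by Tonelli.
  have hsubset : {ω | ENNReal.ofReal ((c - a) * t) < ∫⁻ x in Set.Icc a c,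
        ENNReal.ofReal |cdfGap u ev (fun l => (b l ω : EuclideanSpace ℝ (Fin d))) x|}
      ⊆ {ω | V * ENNReal.ofReal (Real.exp (s * t)) ≤ H ω} := by
    intro ω hω
    rw [Set.mem_ofPred_eq] at hω ⊢
    rw [ENNReal.ofReal_mul (by linarith), ← hV, ← hVvol] at hω
    rw [← hVvol]
    refine mul_exp_le_lintegral_exp ?_ (fun x => abs_nonneg _) hs0 ht hω.le
    refine continuous_abs.measurable.comp ?_
    unfold cdfGap
    exact Finset.measurable_sum _ fun i _ => (hstep i).const_mul _
  have hjoint : AEMeasurable (fun p : Ω × ℝ => ENNReal.ofReal (Real.exp (s *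
      |cdfGap u ev (fun l => (b l p.1 : EuclideanSpace ℝ (Fin d))) p.2|)))
      (P.prod (volume.restrict (Set.Icc a c))) := by
    have h1 : ∀ l, AEMeasurable (fun p : Ω × ℝ => b l p.1)
        (P.prod (volume.restrict (Set.Icc a c))) := fun l => (hb l).aemeasurable.comp_fst
    have h2 : ∀ i, AEMeasurable (fun p : Ω × ℝ => if ev i ≤ p.2 then (1 : ℝ) else 0)
        (P.prod (volume.restrict (Set.Icc a c))) := fun i =>
      ((hstep i).comp measurable_snd).aemeasurable
    unfold cdfGap
    fun_prop
  have hHint : ∫⁻ ω, H ω ∂P ≤ V * ENNReal.ofReal (2 * Real.exp (4 * s ^ 2 / (d * m))) := by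
    simp only [hH]
    rw [lintegral_lintegral_swap hjoint]
    refine (lintegral_mono fun x =>
      lintegral_exp_abs_cdfGap_le hd hm u ev hb hind x s).trans (le_of_eq ?_)
    rw [lintegral_const, hVvol, mul_comm]
  have hmarkov := mul_meas_ge_le_lintegral₀ (μ := P) (hjoint.lintegral_prod_right')
    (V * ENNReal.ofReal (Real.exp (s * t)))
  have hfinal := (mul_le_mul_right (measure_mono (μ := P) hsubset)
    (V * ENNReal.ofReal (Real.exp (s * t)))).trans (hmarkov.trans hHint)
  rw [mul_assoc, ENNReal.mul_le_mul_iff_right hV0 hVtop] at hfinal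
  have hexp : ENNReal.ofReal (2 * Real.exp (4 * s ^ 2 / (d * m)))
      = ENNReal.ofReal (Real.exp (s * t)) *
        ENNReal.ofReal (2 * Real.exp (-(t ^ 2 * d * m / 16))) := by
    rw [← ENNReal.ofReal_mul (Real.exp_pos _).le, mul_left_comm, ← Real.exp_add]
    congr 3
    rw [hs]
    field_simp
    ring
  rwa [hexp, ENNReal.mul_le_mul_iff_right (by simpa using Real.exp_pos _)
    ENNReal.ofReal_ne_top] at hfinal

end Deviation

/-! ### Distribution functions and the two error terms -/

section EigenvectorDensity

variable {d : ℕ} {A : Matrix (Fin d) (Fin d) ℝ}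

instance isFiniteMeasure_eigenvectorDensity (hA : A.IsHermitian) (b : EuclideanSpace ℝ (Fin d)) :
    IsFiniteMeasure (eigenvectorDensity hA b) := by
  have : ∀ i, IsFiniteMeasure (ENNReal.ofReal ((inner ℝ (hA.eigenvectorBasis i) b) ^ 2) •
      Measure.dirac (hA.eigenvalues i)) := fun i => Measure.smul_finite _ ENNReal.ofReal_ne_top
  unfold eigenvectorDensity
  infer_instance

lemma eigenvectorDensity_real_Iic (hA : A.IsHermitian) (b : EuclideanSpace ℝ (Fin d)) (x : ℝ) :
    (eigenvectorDensity hA b).real (Set.Iic x)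
      = ∑ i, inner ℝ (hA.eigenvectorBasis i) b ^ 2 *
        (if hA.eigenvalues i ≤ x then 1 else 0) := by
  rw [Measure.real, eigenvectorDensity, Measure.finsetSum_apply, ENNReal.toReal_sum]
  · refine Finset.sum_congr rfl fun i _ => ?_
    rw [Measure.smul_apply, Measure.dirac_apply' _ measurableSet_Iic, smul_eq_mul,
      ENNReal.toReal_mul, ENNReal.toReal_ofReal (sq_nonneg _)]
    by_cases h : hA.eigenvalues i ≤ x <;> simp [h]
  · intro i _
    rw [Measure.smul_apply, smul_eq_mul]
    exact ENNReal.mul_ne_top ENNReal.ofReal_ne_top (measure_ne_top _ _)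

lemma finiteMoments_eigenvectorDensity (hA : A.IsHermitian) (b : EuclideanSpace ℝ (Fin d)) :
    FiniteMoments (eigenvectorDensity hA b) := by
  intro p
  refine integrable_finsetSum_measure.2 fun i _ => ?_
  exact (integrable_dirac (by simp)).smul_measure ENNReal.ofReal_ne_top

lemma integral_eigenvectorDensity (hA : A.IsHermitian) (b : EuclideanSpace ℝ (Fin d))
    (f : ℝ → ℝ) :
    ∫ x, f x ∂(eigenvectorDensity hA b)
      = ∑ i, inner ℝ (hA.eigenvectorBasis i) b ^ 2 * f (hA.eigenvalues i) := by
  rw [eigenvectorDensity, integral_finsetSum_measure]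
  · refine Finset.sum_congr rfl fun i _ => ?_
    rw [integral_smul_measure, integral_dirac, ENNReal.toReal_ofReal (sq_nonneg _), smul_eq_mul]
  · intro i _
    exact (integrable_dirac (by simp)).smul_measure ENNReal.ofReal_ne_top

lemma isProbabilityMeasure_eigenvectorDensity (hA : A.IsHermitian)
    (b : Metric.sphere (0 : EuclideanSpace ℝ (Fin d)) 1) :
    IsProbabilityMeasure (eigenvectorDensity hA b) := by
  constructor
  rw [eigenvectorDensity, Measure.finsetSum_apply]
  simp only [Measure.smul_apply, measure_univ, smul_eq_mul, mul_one]
  rw [← ENNReal.ofReal_sum_of_nonneg fun i _ => sq_nonneg _, sum_sq_inner_eq_one,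
    ENNReal.ofReal_one]

lemma eigenvalues_mem_Icc (hA : A.IsHermitian) (i : Fin d) :
    hA.eigenvalues i ∈ Set.Icc (lambdaMin hA) (lambdaMax hA) :=
  ⟨ciInf_le (Set.finite_range _).bddBelow i, le_ciSup (Set.finite_range _).bddAbove i⟩

lemma ae_eigenvectorDensity_mem_Icc (hA : A.IsHermitian) (b : EuclideanSpace ℝ (Fin d)) :
    ∀ᵐ x ∂(eigenvectorDensity hA b), x ∈ Set.Icc (lambdaMin hA) (lambdaMax hA) := by
  rw [ae_iff, eigenvectorDensity, Measure.finsetSum_apply]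
  refine Finset.sum_eq_zero fun i _ => ?_
  rw [Measure.smul_apply, Measure.dirac_apply' _ (by exact measurableSet_Icc.compl)]
  have h := eigenvalues_mem_Icc hA i
  rw [Set.mem_Icc] at h
  simp [h]

lemma spectralDensity_real_Iic (hA : A.IsHermitian) (x : ℝ) :
    (spectralDensity hA).real (Set.Iic x)
      = ∑ i, 1 / (d : ℝ) * (if hA.eigenvalues i ≤ x then 1 else 0) := by
  rw [Measure.real, spectralDensity, Measure.smul_apply, Measure.finsetSum_apply, smul_eq_mul,
    ENNReal.toReal_mul, ENNReal.toReal_sum fun i _ => measure_ne_top _ _, Finset.mul_sum]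
  refine Finset.sum_congr rfl fun i _ => ?_
  rw [Measure.dirac_apply' _ measurableSet_Iic]
  by_cases h : hA.eigenvalues i ≤ x <;> simp [h]

lemma slq_real_Iic {m : ℕ} (k : ℕ) (hA : A.IsHermitian) (b : Fin m → EuclideanSpace ℝ (Fin d))
    (x : ℝ) :
    (slq k hA b).real (Set.Iic x)
      = (m : ℝ)⁻¹ * ∑ l, (gaussQuadrature k (eigenvectorDensity hA (b l))).real (Set.Iic x) := by
  have : ∀ l, gaussQuadrature k (eigenvectorDensity hA (b l)) (Set.Iic x) ≠ ∞ := fun l => by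
    unfold gaussQuadrature
    exact measure_ne_top _ _
  rw [Measure.real, slq, Measure.smul_apply, Measure.finsetSum_apply, smul_eq_mul,
    ENNReal.toReal_mul, ENNReal.toReal_sum fun l _ => this l, ENNReal.toReal_inv,
    ENNReal.toReal_natCast]
  rfl

lemma spectralDensity_sub_mean_real_Iic {m : ℕ} (hA : A.IsHermitian)
    (b : Fin m → EuclideanSpace ℝ (Fin d)) (x : ℝ) :
    (spectralDensity hA).real (Set.Iic x)
        - (m : ℝ)⁻¹ * ∑ l, (eigenvectorDensity hA (b l)).real (Set.Iic x)
      = cdfGap hA.eigenvectorBasis hA.eigenvalues b x := by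
  simp only [spectralDensity_real_Iic, eigenvectorDensity_real_Iic, cdfGap, sub_mul]
  rw [Finset.sum_sub_distrib, Finset.sum_comm, Finset.mul_sum]
  congr 1
  refine Finset.sum_congr rfl fun i _ => ?_
  rw [← Finset.sum_mul, mul_assoc]

variable {m : ℕ}

lemma sum_mean_weights (hm : 1 ≤ m) (hA : A.IsHermitian)
    (b : Fin m → Metric.sphere (0 : EuclideanSpace ℝ (Fin d)) 1) :
    ∑ i, (m : ℝ)⁻¹ * ∑ l, inner ℝ (hA.eigenvectorBasis i)
      (b l : EuclideanSpace ℝ (Fin d)) ^ 2 = 1 := by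
  have hm0 : (m : ℝ) ≠ 0 := by
    have : m ≠ 0 := by omega
    exact_mod_cast this
  rw [← Finset.mul_sum, Finset.sum_comm]
  simp only [sum_sq_inner_eq_one]
  simp [hm0]

lemma sum_cdfGap_weights (hd : 1 ≤ d) (hm : 1 ≤ m) (hA : A.IsHermitian)
    (b : Fin m → Metric.sphere (0 : EuclideanSpace ℝ (Fin d)) 1) :
    ∑ i, (1 / (d : ℝ) - (m : ℝ)⁻¹ * ∑ l, inner ℝ (hA.eigenvectorBasis i)
      (b l : EuclideanSpace ℝ (Fin d)) ^ 2) = 0 := by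
  have hd0 : (d : ℝ) ≠ 0 := by
    have : d ≠ 0 := by omega
    exact_mod_cast this
  rw [Finset.sum_sub_distrib, sum_mean_weights hm hA b]
  simp [hd0]

/-- A sure bound for the cases `ε ≥ 1/2` and `λ_min = λ_max`: the weights sum to zero, so the
duality estimate applies with `k = 1`. -/
lemma lintegral_abs_cdfGap_le (hd : 1 ≤ d) (hm : 1 ≤ m) (hA : A.IsHermitian)
    (b : Fin m → Metric.sphere (0 : EuclideanSpace ℝ (Fin d)) 1) :
    ∫⁻ x, ENNReal.ofReal |cdfGap hA.eigenvectorBasis hA.eigenvalues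
        (fun l => (b l : EuclideanSpace ℝ (Fin d))) x|
      ≤ ENNReal.ofReal (6 * (lambdaMax hA - lambdaMin hA)) := by
  have hab : lambdaMin hA ≤ lambdaMax hA :=
    (eigenvalues_mem_Icc hA ⟨0, hd⟩).1.trans (eigenvalues_mem_Icc hA ⟨0, hd⟩).2
  have hd0 : (d : ℝ) ≠ 0 := by
    have : d ≠ 0 := by omega
    exact_mod_cast this
  have h := lintegral_abs_sum_step_le (k := 1) hab
    (c := fun i => 1 / (d : ℝ) - (m : ℝ)⁻¹ * ∑ l, inner ℝ (hA.eigenvectorBasis i)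
      (b l : EuclideanSpace ℝ (Fin d)) ^ 2) (x := hA.eigenvalues)
    (fun i _ => eigenvalues_mem_Icc hA i) ?_ le_rfl ?_
  · simpa [cdfGap] using h
  · refine (Finset.sum_le_sum fun i _ => abs_sub _ _).trans ?_
    rw [Finset.sum_add_distrib]
    have h1 : ∀ i, |(m : ℝ)⁻¹ * ∑ l, inner ℝ (hA.eigenvectorBasis i)
        (b l : EuclideanSpace ℝ (Fin d)) ^ 2| = (m : ℝ)⁻¹ * ∑ l,
          inner ℝ (hA.eigenvectorBasis i) (b l : EuclideanSpace ℝ (Fin d)) ^ 2 := fun i =>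
      abs_of_nonneg (mul_nonneg (by positivity) (Finset.sum_nonneg fun l _ => sq_nonneg _))
    simp only [h1]
    rw [sum_mean_weights hm hA b]
    simp [hd0]
    norm_num
  · intro p hp
    rw [Nat.lt_one_iff] at hp
    obtain ⟨z, rfl⟩ := Polynomial.natDegree_eq_zero.1 hp
    simp only [Polynomial.eval_C]
    rw [← Finset.sum_mul, sum_cdfGap_weights hd hm hA b, zero_mul]

lemma cdfGap_eq_zero (hd : 1 ≤ d) (hm : 1 ≤ m) (hA : A.IsHermitian)
    (b : Fin m → Metric.sphere (0 : EuclideanSpace ℝ (Fin d)) 1) {x : ℝ}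
    (hx : x ∉ Set.Icc (lambdaMin hA) (lambdaMax hA)) :
    cdfGap hA.eigenvectorBasis hA.eigenvalues
      (fun l => (b l : EuclideanSpace ℝ (Fin d))) x = 0 := by
  rw [Set.mem_Icc, not_and_or, not_le, not_le] at hx
  rcases hx with hx | hx
  · refine Finset.sum_eq_zero fun i _ => ?_
    rw [if_neg (not_le.2 (hx.trans_le (eigenvalues_mem_Icc hA i).1)), mul_zero]
  · rw [← sum_cdfGap_weights hd hm hA b]
    refine Finset.sum_congr rfl fun i _ => ?_
    rw [if_pos ((eigenvalues_mem_Icc hA i).2.trans hx.le), mul_one]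

/-- The Wasserstein distance between the mean of the eigenvector densities and the mean of their
Gaussian quadrature rules. -/
theorem lintegral_abs_mean_sub_slq_le (hd : 1 ≤ d) (hm : 1 ≤ m) (hA : A.IsHermitian)
    (b : Fin m → Metric.sphere (0 : EuclideanSpace ℝ (Fin d)) 1) {k : ℕ} (hk : 1 ≤ k) :
    ∫⁻ x, ENNReal.ofReal |(m : ℝ)⁻¹ * ∑ l, (eigenvectorDensity hA (b l)).real (Set.Iic x)
        - (slq k hA fun l => (b l : EuclideanSpace ℝ (Fin d))).real (Set.Iic x)|
      ≤ ENNReal.ofReal (6 * (lambdaMax hA - lambdaMin hA) / k) := by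
  have hab : lambdaMin hA ≤ lambdaMax hA :=
    (eigenvalues_mem_Icc hA ⟨0, hd⟩).1.trans (eigenvalues_mem_Icc hA ⟨0, hd⟩).2
  have hm0 : (m : ℝ) ≠ 0 := by
    have : m ≠ 0 := by omega
    exact_mod_cast this
  have hprob := fun l => isProbabilityMeasure_eigenvectorDensity hA (b l)
  set M := fun l => jacobiMatrix_isHermitian (eigenvectorDensity hA (b l)) k with hM
  -- All the eigenvector densities and their quadrature rules form one signed measure, so the
  -- duality estimate is applied once to the whole average.
  set c : (Fin m × Fin d) ⊕ (Fin m × Fin k) → ℝ := Sum.elim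
    (fun q => (m : ℝ)⁻¹ * inner ℝ (hA.eigenvectorBasis q.2)
      (b q.1 : EuclideanSpace ℝ (Fin d)) ^ 2)
    (fun q => -((m : ℝ)⁻¹ * inner ℝ ((M q.1).eigenvectorBasis q.2) (firstBasisVector k) ^ 2))
    with hc
  set y : (Fin m × Fin d) ⊕ (Fin m × Fin k) → ℝ := Sum.elim
    (fun q => hA.eigenvalues q.2) (fun q => (M q.1).eigenvalues q.2) with hy
  have hquad : ∀ (l : Fin m) (p : Polynomial ℝ), p.natDegree < k →
      ∑ r, inner ℝ ((M l).eigenvectorBasis r) (firstBasisVector k) ^ 2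
        * p.eval ((M l).eigenvalues r)
      = ∑ i, inner ℝ (hA.eigenvectorBasis i) (b l : EuclideanSpace ℝ (Fin d)) ^ 2
        * p.eval (hA.eigenvalues i) := by
    intro l p hp
    rw [← integral_eigenvectorDensity hA (b l) fun x => p.eval x]
    exact sum_gaussQuadrature_eval (finiteMoments_eigenvectorDensity hA (b l)) hp
  have hfun : ∀ (φ : ℝ → ℝ), ∑ q, c q * φ (y q)
      = (m : ℝ)⁻¹ * ∑ l, ∑ i, inner ℝ (hA.eigenvectorBasis i)
          (b l : EuclideanSpace ℝ (Fin d)) ^ 2 * φ (hA.eigenvalues i)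
        - (m : ℝ)⁻¹ * ∑ l, ∑ r, inner ℝ ((M l).eigenvectorBasis r) (firstBasisVector k) ^ 2
          * φ ((M l).eigenvalues r) := by
    intro φ
    rw [Fintype.sum_sum_type, sub_eq_add_neg]
    simp only [hc, hy, Sum.elim_inl, Sum.elim_inr, Fintype.sum_prod_type, neg_mul,
      Finset.sum_neg_distrib, mul_assoc, ← Finset.mul_sum]
  have h := lintegral_abs_sum_step_le (k := k) hab (c := c) (x := y) ?_ ?_ hk ?_
  · refine le_of_eq_of_le (lintegral_congr fun x => ?_) h
    congr 2
    rw [slq_real_Iic, hfun fun z => if z ≤ x then 1 else 0]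
    simp only [gaussQuadrature, eigenvectorDensity_real_Iic]
  · rintro (⟨l, i⟩ | ⟨l, r⟩) hq
    · exact eigenvalues_mem_Icc hA i
    · refine gaussQuadrature_node_mem (finiteMoments_eigenvectorDensity hA (b l))
        (ae_eigenvectorDensity_mem_Icc hA (b l)) r fun h0 => hq ?_
      simp only [hc, Sum.elim_inr]
      rw [h0]
      simp
  · have h1 : ∀ l, ∑ r, inner ℝ ((M l).eigenvectorBasis r) (firstBasisVector k) ^ 2 = 1 := by
      intro l
      have := hquad l 1 (by simp; omega)
      simpa only [Polynomial.eval_one, mul_one, sum_sq_inner_eq_one] using this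
    rw [Fintype.sum_sum_type]
    simp only [hc, Sum.elim_inl, Sum.elim_inr, Fintype.sum_prod_type, abs_neg, abs_mul, abs_pow,
      sq_abs, ← Finset.mul_sum, sum_sq_inner_eq_one, h1]
    simp [hm0]
    norm_num
  · intro p hp
    rw [hfun fun z => p.eval z]
    simp only [hquad _ p hp, sub_self]

lemma wasserstein_slq_le (hA : A.IsHermitian)
    (b : Fin m → Metric.sphere (0 : EuclideanSpace ℝ (Fin d)) 1) (k : ℕ) :
    wasserstein (spectralDensity hA) (slq k hA fun l => (b l : EuclideanSpace ℝ (Fin d)))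
      ≤ (∫⁻ x, ENNReal.ofReal |cdfGap hA.eigenvectorBasis hA.eigenvalues
          (fun l => (b l : EuclideanSpace ℝ (Fin d))) x|)
        + ∫⁻ x, ENNReal.ofReal |(m : ℝ)⁻¹ * ∑ l, (eigenvectorDensity hA (b l)).real (Set.Iic x)
          - (slq k hA fun l => (b l : EuclideanSpace ℝ (Fin d))).real (Set.Iic x)| := by
  rw [← lintegral_add_left]
  · refine lintegral_mono fun x => ?_
    rw [← spectralDensity_sub_mean_real_Iic, ← ENNReal.ofReal_add (abs_nonneg _) (abs_nonneg _)]
    exact ENNReal.ofReal_le_ofReal (abs_sub_le _ _ _)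
  · refine ENNReal.measurable_ofReal.comp (continuous_abs.measurable.comp ?_)
    unfold cdfGap
    exact Finset.measurable_sum _ fun i _ => Measurable.const_mul
      (Measurable.ite measurableSet_Ici measurable_const measurable_const) _

end EigenvectorDensity

/-! ### Choice of constants and conclusion -/

/-- Of the squared logarithm only the lower bound `1/4` is used: it gives `exp(-4N) ≤ εδ`, and `2ε <
1` absorbs the prefactor. -/
lemma two_mul_exp_le {ε δ : ℝ} (hε : 0 < ε) (hε2 : ε < 1 / 2) (hδ : 0 < δ) (hδ1 : δ < 1) {N : ℝ}
    (h : Real.log (1 / ε) ^ 2 * Real.log (1 / (ε * δ)) ≤ N) :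
    2 * Real.exp (-(4 * N)) ≤ δ := by
  have h1 : 1 / 2 ≤ Real.log (1 / ε) := by
    have : (2 : ℝ) ≤ 1 / ε := by
      rw [le_div_iff₀ hε]
      linarith
    have := Real.log_le_log two_pos this
    linarith [Real.log_two_gt_d9]
  have h2 : 0 ≤ Real.log (1 / (ε * δ)) := by
    refine Real.log_nonneg ?_
    rw [le_div_iff₀ (by positivity)]
    nlinarith
  have h3 : (1 / 2) ^ 2 * Real.log (1 / (ε * δ)) ≤ N :=
    (mul_le_mul_of_nonneg_right (pow_le_pow_left₀ (by norm_num) h1 2) h2).trans h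
  have h4 : -(4 * N) ≤ Real.log (ε * δ) := by
    rw [one_div (ε * δ), Real.log_inv] at h3
    linarith
  have h5 := Real.exp_le_exp.2 h4
  rw [Real.exp_log (by positivity)] at h5
  nlinarith

end SLQ

theorem theorem8p4 :
    ∃ C : ℝ, 0 < C ∧
      ∀ (d m k : ℕ) (ε δ : ℝ) (A : Matrix (Fin d) (Fin d) ℝ) (hA : A.IsHermitian),
        1 ≤ d → 1 ≤ m → 0 < ε → 0 < δ →
        Real.log (1 / ε) ^ 2 * Real.log (1 / (ε * δ)) / (d * ε ^ 2) ≤ (m : ℝ) →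
        1 / ε ≤ (k : ℝ) →
        ∀ (Ω : Type*) [MeasurableSpace Ω] (P : Measure Ω) [IsProbabilityMeasure P]
          (b : Fin m → Ω → Metric.sphere (0 : EuclideanSpace ℝ (Fin d)) 1),
          (∀ l, HasLaw (b l) (SLQ.sphereUniform d) P) → iIndepFun b P →
          P {ω | ENNReal.ofReal (|SLQ.lambdaMax hA - SLQ.lambdaMin hA| * (C * ε)) <
                SLQ.wasserstein (SLQ.spectralDensity hA)
                  (SLQ.slq k hA fun l => (b l ω : EuclideanSpace ℝ (Fin d)))}
            ≤ ENNReal.ofReal δ := by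
  -- For `ε ≥ 1/2` the sure bounds add up to `12 (c - a) ≤ 24 ε (c - a)`; the main case needs only
  -- `8 + 6 = 14`.
  refine ⟨24, by norm_num, ?_⟩
  intro d m k ε δ A hA hd hm hε hδ hmle hkle Ω _ P _ b hb hind
  have hk0 : (0 : ℝ) < k := lt_of_lt_of_le (by positivity) hkle
  have hk : 1 ≤ k := by
    have : 0 < k := by exact_mod_cast hk0
    omega
  have hd0 : (0 : ℝ) < d := by exact_mod_cast hd
  set a := SLQ.lambdaMin hA with ha
  set c := SLQ.lambdaMax hA with hc
  have hac : a ≤ c :=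
    (SLQ.eigenvalues_mem_Icc hA ⟨0, hd⟩).1.trans (SLQ.eigenvalues_mem_Icc hA ⟨0, hd⟩).2
  have hW := fun ω => SLQ.wasserstein_slq_le hA (fun l => b l ω) k
  have hW1 := fun ω => SLQ.lintegral_abs_cdfGap_le hd hm hA fun l => b l ω
  have hW2 := fun ω => SLQ.lintegral_abs_mean_sub_slq_le hd hm hA (fun l => b l ω) hk
  simp only [← ha, ← hc] at hW1 hW2
  rw [abs_of_nonneg (sub_nonneg.2 hac)]
  by_cases htriv : 1 / 2 ≤ ε ∨ a = c
  · refine le_of_eq_of_le ?_ zero_le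
    convert measure_empty (μ := P)
    refine Set.eq_empty_of_forall_notMem fun ω hω => ?_
    rw [Set.mem_ofPred_eq] at hω
    refine absurd hω (not_lt.2 ((hW ω).trans ((add_le_add (hW1 ω) (hW2 ω)).trans ?_)))
    rw [← ENNReal.ofReal_add (by linarith) (by
      have := sub_nonneg.2 hac
      positivity)]
    refine ENNReal.ofReal_le_ofReal ?_
    rcases htriv with h | h
    · have h1 : 6 * (c - a) / k ≤ 6 * (c - a) :=
        div_le_self (by linarith) (by exact_mod_cast hk)
      nlinarith
    · simp [h]
  rw [not_or, not_le] at htriv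
  obtain ⟨hε2, hne⟩ := htriv
  have hlt : a < c := lt_of_le_of_ne hac hne
  rcases le_or_gt 1 δ with hδ1 | hδ1
  · refine prob_le_one.trans ?_
    rw [← ENNReal.ofReal_one]
    exact ENNReal.ofReal_le_ofReal hδ1
  -- With `t = 8ε` the exponent `t²dm/16` becomes `4dmε²`, the form `4N` required by
  -- `two_mul_exp_le`.
  have hconc := SLQ.measure_lintegral_cdfGap_le hd hm hA.eigenvectorBasis hA.eigenvalues hb hind
    hlt (t := 8 * ε) (by positivity)
  refine (measure_mono fun ω hω => ?_).trans (hconc.trans (ENNReal.ofReal_le_ofReal ?_))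
  · rw [Set.mem_ofPred_eq] at hω ⊢
    by_contra hcon
    rw [not_lt] at hcon
    refine absurd hω (not_lt.2 ((hW ω).trans ?_))
    have hgap : ∫⁻ x, ENNReal.ofReal |SLQ.cdfGap hA.eigenvectorBasis hA.eigenvalues
          (fun l => (b l ω : EuclideanSpace ℝ (Fin d))) x|
        = ∫⁻ x in Set.Icc a c, ENNReal.ofReal |SLQ.cdfGap hA.eigenvectorBasis hA.eigenvalues
          (fun l => (b l ω : EuclideanSpace ℝ (Fin d))) x| := by
      refine (setLIntegral_eq_of_support_subset fun x hx => ?_).symm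
      by_contra hx'
      refine hx ?_
      beta_reduce
      rw [SLQ.cdfGap_eq_zero hd hm hA (fun l => b l ω) hx']
      simp
    rw [hgap]
    refine (add_le_add hcon (hW2 ω)).trans ?_
    have h0 : 0 ≤ c - a := by linarith
    rw [← ENNReal.ofReal_add (by positivity) (by positivity)]
    refine ENNReal.ofReal_le_ofReal ?_
    have h1 : 6 * (c - a) / k ≤ 6 * (c - a) * ε := by
      rw [div_eq_mul_one_div]
      refine mul_le_mul_of_nonneg_left ?_ (by linarith)
      rw [div_le_iff₀ hk0]
      rwa [div_le_iff₀ hε, mul_comm] at hkle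
    nlinarith
  · have h := hmle
    rw [div_le_iff₀ (by positivity)] at h
    refine le_trans (le_of_eq ?_) (SLQ.two_mul_exp_le hε hε2 hδ hδ1 h)
    congr 2
    ring
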